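/- Let $(M,\omega)$ be a compact symplectic manifold (smooth, Hausdorff, without boundary) of dimension $2n$, and let $J$ be a smooth almost complex structure on $M$ compatible with $\omega$, i.e. $J^2=-1$, $\omega(J\cdot,J\cdot)=\omega$ and $\omega(v,Jv)>0$ for $v\neq 0$. Let $g_J(v,w)=\omega(v,Jw)$ be the associated Riemannian metric, and for $\varepsilon>0$ let $TM_\varepsilon=\{v\in TM : g_J(v,v)<\varepsilon^2\}$ be the $\varepsilon$-ball subbundle of the tangent bundle. Let $B_\varepsilon\subset\mathbb{C}^n$ be the open ball of radius $\varepsilon$ about the origin, with the standard symplectic form $\omega_0=\sum_j dx_j\wedge dy_j$. Then there is $\varepsilon_0>0$ such that for every $0<\varepsilon\le\varepsilon_0$ there exists a smooth map $\phi:TM_\varepsilon\to M$ with $\phi(0_m)=m$ for all $m\in M$ (where $0_m$ is the zero vector of $T_mM$) and with the following property. For every $m\in M$ and every unitary frame at $m$, i.e. every real linear isomorphism $u:\mathbb{C}^n\to T_mM$ with $u(iz)=J_m u(z)$ and $u^*\omega_m=\omega_0$ (such frames exist at every point), let $i_m:B_\varepsilon\to TM_\varepsilon$, $z\mapsto u(z)\in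 T_mM$, be the corresponding inclusion of the fibre over $m$. Then $\phi\circ i_m:B_\varepsilon\to M$ is a symplectic embedding of $(B_\varepsilon,\omega_0)$ into $(M,\omega)$, i.e. a smooth embedding with $(\phi\circ i_m)^*\omega=\omega_0$. -/

import Mathlib

open scoped Manifold ContDiff Topology

noncomputable section

namespace SymplecticThickening

section Forms

variable {E : Type*} [NormedAddCommGroup E] [NormedSpace ℝ E]
variable {M : Type*} [TopologicalSpace M] [ChartedSpace E M]

/-- The expression of a 2-form `Ω` on the manifold `M` in the preferred chart at `p`: the pullback
of `Ω` by the inverse of the chart, a 2-form on (an open subset of) the vector space `E`. -/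
def localForm (Ω : ∀ m : M, TangentSpace 𝓘(ℝ, E) m [⋀^Fin 2]→L[ℝ] ℝ) (p : M) (x : E) :
    E [⋀^Fin 2]→L[ℝ] ℝ :=
  (Ω ((extChartAt 𝓘(ℝ, E) p).symm x)).compContinuousLinearMap
    (mfderiv 𝓘(ℝ, E) 𝓘(ℝ, E) (extChartAt 𝓘(ℝ, E) p).symm x)

/-- A symplectic form on the boundaryless manifold `M`: a differential 2-form which is smooth,
closed and nondegenerate. Smoothness and closedness are expressed in the charts; the targets of
the charts are open in `E`, so that the exterior derivative there only sees values of the form on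
the domain of the chart. -/
structure IsSymplecticForm (Ω : ∀ m : M, TangentSpace 𝓘(ℝ, E) m [⋀^Fin 2]→L[ℝ] ℝ) : Prop where
  smooth : ∀ p : M, ContDiffOn ℝ ∞ (localForm Ω p) (extChartAt 𝓘(ℝ, E) p).target
  closed : ∀ p : M, ∀ x ∈ (extChartAt 𝓘(ℝ, E) p).target, extDeriv (localForm Ω p) x = 0
  nondegenerate : ∀ (m : M) (v : TangentSpace 𝓘(ℝ, E) m),
    (∀ w : TangentSpace 𝓘(ℝ, E) m, Ω m ![v, w] = 0) → v = 0

/-- A smooth almost complex structure `J` on `M` that is compatible with the 2-form `Ω`. -/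
structure IsCompatibleAlmostComplex [IsManifold 𝓘(ℝ, E) ∞ M]
    (Ω : ∀ m : M, TangentSpace 𝓘(ℝ, E) m [⋀^Fin 2]→L[ℝ] ℝ)
    (J : ∀ m : M, TangentSpace 𝓘(ℝ, E) m →L[ℝ] TangentSpace 𝓘(ℝ, E) m) : Prop where
  smooth : ContMDiff 𝓘(ℝ, E) (𝓘(ℝ, E).prod 𝓘(ℝ, E →L[ℝ] E)) ∞
    (fun m : M ↦ (Bundle.TotalSpace.mk' (E →L[ℝ] E) m (J m) :
      Bundle.TotalSpace (E →L[ℝ] E)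
        (fun m : M ↦ TangentSpace 𝓘(ℝ, E) m →L[ℝ] TangentSpace 𝓘(ℝ, E) m)))
  sq_eq_neg : ∀ (m : M) (v : TangentSpace 𝓘(ℝ, E) m), J m (J m v) = -v
  invariant : ∀ (m : M) (v w : TangentSpace 𝓘(ℝ, E) m), Ω m ![J m v, J m w] = Ω m ![v, w]
  pos : ∀ (m : M) (v : TangentSpace 𝓘(ℝ, E) m), v ≠ 0 → 0 < Ω m ![v, J m v]

/-- The `ε`-ball subbundle of the tangent bundle, for the Riemannian metric
`g(v, w) = Ω(v, J w)`: the tangent vectors `v` with `g(v, v) < ε ^ 2`. -/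
def ballBundle (Ω : ∀ m : M, TangentSpace 𝓘(ℝ, E) m [⋀^Fin 2]→L[ℝ] ℝ)
    (J : ∀ m : M, TangentSpace 𝓘(ℝ, E) m →L[ℝ] TangentSpace 𝓘(ℝ, E) m) (ε : ℝ) :
    Set (TangentBundle 𝓘(ℝ, E) M) :=
  {v | Ω v.proj ![v.snd, J v.proj v.snd] < ε ^ 2}

end Forms

/-- The standard symplectic form `∑ dxⱼ ∧ dyⱼ` on `ℂⁿ`, where `zⱼ = xⱼ + i yⱼ`. -/
def stdForm (n : ℕ) (a b : EuclideanSpace ℂ (Fin n)) : ℝ :=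
  ∑ j, ((a j).re * (b j).im - (a j).im * (b j).re)

/-- The open ball `B_ε` of radius `ε` around the origin of `ℂⁿ`. -/
def stdBall (n : ℕ) (ε : ℝ) : TopologicalSpace.Opens (EuclideanSpace ℂ (Fin n)) :=
  ⟨Metric.ball 0 ε, Metric.isOpen_ball⟩

section Embeddings

variable {E : Type*} [NormedAddCommGroup E] [NormedSpace ℝ E]
variable {M : Type*} [TopologicalSpace M] [ChartedSpace E M]

/-- The restriction of `f : ℂⁿ → M` to the ball `B_ε` is a symplectic embedding of
`(B_ε, stdForm n)` into `(M, Ω)`: a smooth embedding that pulls `Ω` back to the standard form. -/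
structure IsSymplecticBallEmbedding (Ω : ∀ m : M, TangentSpace 𝓘(ℝ, E) m [⋀^Fin 2]→L[ℝ] ℝ)
    (n : ℕ) (ε : ℝ) (f : EuclideanSpace ℂ (Fin n) → M) : Prop where
  smoothEmbedding : Manifold.IsSmoothEmbedding 𝓘(ℝ, EuclideanSpace ℂ (Fin n)) 𝓘(ℝ, E) ∞
    (fun z : stdBall n ε ↦ f z)
  pullback_eq : ∀ z ∈ stdBall n ε, ∀ a b : EuclideanSpace ℂ (Fin n),
    Ω (f z) ![mfderiv 𝓘(ℝ, EuclideanSpace ℂ (Fin n)) 𝓘(ℝ, E) f z a,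
      mfderiv 𝓘(ℝ, EuclideanSpace ℂ (Fin n)) 𝓘(ℝ, E) f z b] = stdForm n a b

/-- A unitary frame of `(T_m M, Ω_m, J_m)`: a real linear isomorphism from `ℂⁿ` onto `T_m M` that
carries multiplication by `i` to `J_m` and the standard symplectic form to `Ω_m` (hence the
Euclidean metric to the metric `Ω_m(·, J_m ·)`). -/
structure IsUnitaryFrame (Ω : ∀ m : M, TangentSpace 𝓘(ℝ, E) m [⋀^Fin 2]→L[ℝ] ℝ)
    (J : ∀ m : M, TangentSpace 𝓘(ℝ, E) m →L[ℝ] TangentSpace 𝓘(ℝ, E) m) {n : ℕ} (m : M)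
    (u : EuclideanSpace ℂ (Fin n) ≃L[ℝ] TangentSpace 𝓘(ℝ, E) m) : Prop where
  map_I_smul : ∀ z : EuclideanSpace ℂ (Fin n), u (Complex.I • z) = J m (u z)
  map_form : ∀ z w : EuclideanSpace ℂ (Fin n), Ω m ![u z, u w] = stdForm n z w

end Embeddings

end SymplecticThickening

end

set_option linter.unusedSectionVars false
set_option maxSynthPendingDepth 4

/-! The map `φ` is built with more structure than required (`IsSymplecticThickeningOn`): on an open
neighbourhood of the zero section it is smooth, each fibre map `v ↦ φ ⟨m, v⟩` pulls `Ω` back to the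
constant form `Ω m`, takes `0` to `m`, and has derivative the identity at `0`. In a Darboux chart
the affine map `(x, w) ↦ x + w` is of this kind. Local existence is thus Darboux's theorem, proved
by Moser's method in `exists_darboux_coordinates`; the flow it needs comes from the inverse function
theorem in the space of continuous curves.

Symplectic maps cannot be averaged by a partition of unity, so the local solutions are glued by
Alexander's trick. A family `f (x, w)` with `f (x, 0) = x` and fibre derivative the identity at `w =
0` is joined to `x + w` by `x + (f (x, s w) - x) / s`. The derivative of this in `w` is that of `f`
at `(x, s w)`, so it is symplectic for every `s`. Only derivatives along the fibre matter, so `s`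
may be a function of `x`. With `s` obtained from a bump function, any `φ` can be made affine near a
given point while remaining good wherever it was good (`exists_nhds_extension`). Finitely many such
modifications cover a compact manifold.

By compactness a small ball bundle lies in the good neighbourhood and `φ` is injective on its fibres
(`IsSymplecticThickeningOn.exists_radius`). Preserving a nondegenerate form makes the fibre
derivatives invertible, so each fibre map is an injective local diffeomorphism, hence an embedding;
unitary frames transfer this to balls in `ℂⁿ`. -/

namespace SymplecticThickening

open Set Filter

/-! ### Smooth local inverses, and smoothness of superposition operators on spaces of continuous
maps. -/

section Superposition

universe u

/-- The inverse function theorem for smooth maps on an open set: the local inverse is smooth on its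
whole domain. -/
theorem exists_openPartialHomeomorph_of_contDiffOn {E F : Type*} [NormedAddCommGroup E]
    [NormedSpace ℝ E] [CompleteSpace E] [NormedAddCommGroup F] [NormedSpace ℝ F]
    {f : E → F} {U : Set E} (hU : IsOpen U) (hf : ContDiffOn ℝ ∞ f U) {a : E} (ha : a ∈ U)
    (f' : E ≃L[ℝ] F) (hf' : HasFDerivAt f (f' : E →L[ℝ] F) a) :
    ∃ h : OpenPartialHomeomorph E F, a ∈ h.source ∧ h.source ⊆ U ∧ (∀ x, h x = f x) ∧
      ContDiffOn ℝ ∞ h.symm h.target := by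
  have hfa : ContDiffAt ℝ ∞ f a := hf.contDiffAt (hU.mem_nhds ha)
  have hne : (∞ : ℕ∞ω) ≠ 0 := by simp
  set h₀ := hfa.toOpenPartialHomeomorph f hf' hne
  -- Invertible operators form an open set; restricting to points with invertible derivative makes
  -- the inverse smooth at every point of the target, not only at `f a`.
  set W : Set E := U ∩ (fderiv ℝ f) ⁻¹'
    (range (ContinuousLinearEquiv.toContinuousLinearMap : (E ≃L[ℝ] F) → (E →L[ℝ] F)))
  have hW : IsOpen W :=
    (hf.continuousOn_fderiv_of_isOpen hU (by simp)).isOpen_inter_preimage hU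
      ContinuousLinearEquiv.isOpen
  refine ⟨h₀.restrOpen W hW, ?_, ?_, fun x ↦ ?_, ?_⟩
  · rw [OpenPartialHomeomorph.restrOpen_source]
    exact ⟨hfa.mem_toOpenPartialHomeomorph_source hf' hne, ha, f', hf'.fderiv.symm⟩
  · rw [OpenPartialHomeomorph.restrOpen_source]
    exact fun x hx ↦ hx.2.1
  · rfl
  · intro y hy
    have hs := (h₀.restrOpen W hW).map_target hy
    rw [OpenPartialHomeomorph.restrOpen_source] at hs
    obtain ⟨-, hxU, e, he⟩ := hs
    have hc : ContDiffAt ℝ ∞ f ((h₀.restrOpen W hW).symm y) := hf.contDiffAt (hU.mem_nhds hxU)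
    refine ((h₀.restrOpen W hW).contDiffAt_symm (f₀' := e) hy ?_ hc).contDiffWithinAt
    rw [he]
    exact (hc.differentiableAt hne).hasFDerivAt

variable {X : Type*} [TopologicalSpace X]
variable {F G : Type u} [NormedAddCommGroup F] [NormedAddCommGroup G]

open Classical in
/-- The superposition operator `γ ↦ f ∘ γ` between spaces of continuous maps (`0` where `f ∘ γ` is
not continuous). -/
noncomputable def postcomp (f : F → G) (γ : C(X, F)) : C(X, G) :=
  if h : Continuous (fun t ↦ f (γ t)) then ⟨_, h⟩ else 0

theorem postcomp_apply {f : F → G} {U : Set F} (hf : ContinuousOn f U) {γ : C(X, F)}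
    (hγ : ∀ t, γ t ∈ U) (t : X) : postcomp f γ t = f (γ t) := by
  have h : Continuous (fun t ↦ f (γ t)) := hf.comp_continuous γ.continuous hγ
  simp [postcomp, h]

variable [CompactSpace X]

theorem isOpen_setOf_forall_mem {U : Set F} (hU : IsOpen U) :
    IsOpen {γ : C(X, F) | ∀ t, γ t ∈ U} := by
  have := ContinuousMap.isOpen_setOfPred_mapsTo (X := X) isCompact_univ hU
  simpa [MapsTo] using this

variable [NormedSpace ℝ F] [NormedSpace ℝ G]

variable (X F G) in
/-- Pointwise application of a family of operators to a family of vectors. -/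
noncomputable def pointwiseApply : C(X, F →L[ℝ] G) →L[ℝ] C(X, F) →L[ℝ] C(X, G) :=
  LinearMap.mkContinuous₂
    (LinearMap.mk₂ ℝ (fun (A : C(X, F →L[ℝ] G)) (γ : C(X, F)) ↦
      (⟨fun t ↦ A t (γ t), A.continuous.clm_apply γ.continuous⟩ : C(X, G)))
      (fun _ _ _ ↦ by ext; simp) (fun _ _ _ ↦ by ext; simp)
      (fun _ _ _ ↦ by ext; simp) (fun _ _ _ ↦ by ext; simp)) 1
    (fun A γ ↦ by
      rw [ContinuousMap.norm_le _ (by positivity)]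
      intro t
      simp only [LinearMap.mk₂_apply, ContinuousMap.coe_mk, one_mul]
      exact (A t).le_of_opNorm_le_of_le (A.norm_coe_le_norm t) (γ.norm_coe_le_norm t))

@[simp]
theorem pointwiseApply_apply (A : C(X, F →L[ℝ] G)) (γ : C(X, F)) (t : X) :
    pointwiseApply X F G A γ t = A t (γ t) := rfl

/-- The first-order estimate for `f` is uniform along `γ`: strict differentiability at `γ t` gives
it for times near `t`, continuity of `fderiv ℝ f` moves the base point of the derivative, and
compactness of `X` gives one radius for all times. -/
theorem hasFDerivAt_postcomp {f : F → G} {U : Set F} (hU : IsOpen U) (hf : ContDiffOn ℝ 1 f U)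
    {γ : C(X, F)} (hγ : ∀ t, γ t ∈ U) :
    HasFDerivAt (postcomp f) (pointwiseApply X F G (postcomp (fderiv ℝ f) γ)) γ := by
  rw [hasFDerivAt_iff_isLittleO_nhds_zero, Asymptotics.isLittleO_iff]
  intro c hc
  have hD : ContinuousOn (fderiv ℝ f) U := hf.continuousOn_fderiv_of_isOpen hU le_rfl
  have key : ∀ᶠ h : F in 𝓝 0, ∀ t ∈ (univ : Set X),
      ‖f (γ t + h) - f (γ t) - fderiv ℝ f (γ t) h‖ ≤ c * ‖h‖ := by
    refine isCompact_univ.eventually_forall_of_forall_eventually fun t _ ↦ ?_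
    have hft : ContDiffAt ℝ 1 f (γ t) := hf.contDiffAt (hU.mem_nhds (hγ t))
    have hs := hft.hasStrictFDerivAt one_ne_zero
    have h1 := hs.isLittleO.def (half_pos hc)
    have tend : Tendsto (fun z : F × X ↦ (γ z.2 + z.1, γ z.2)) (𝓝 (0, t)) (𝓝 (γ t, γ t)) := by
      have : Continuous (fun z : F × X ↦ (γ z.2 + z.1, γ z.2)) := by fun_prop
      simpa using this.tendsto ((0 : F), t)
    have h2 : ∀ᶠ x in 𝓝 (γ t), ‖fderiv ℝ f x - fderiv ℝ f (γ t)‖ ≤ c / 2 := by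
      have hca : ContinuousAt (fderiv ℝ f) (γ t) := hD.continuousAt (hU.mem_nhds (hγ t))
      have := hca.eventually (Metric.closedBall_mem_nhds _ (half_pos hc))
      filter_upwards [this] with x hx
      simpa [dist_eq_norm] using hx
    have tend2 : Tendsto (fun z : F × X ↦ γ z.2) (𝓝 (0, t)) (𝓝 (γ t)) :=
      (show Continuous (fun z : F × X ↦ γ z.2) by fun_prop).tendsto ((0 : F), t)
    filter_upwards [tend.eventually h1, tend2.eventually h2] with z hz1 hz2
    simp only [add_sub_cancel_left] at hz1
    have hz3 : ‖(fderiv ℝ f (γ z.2) - fderiv ℝ f (γ t)) z.1‖ ≤ c / 2 * ‖z.1‖ :=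
      ContinuousLinearMap.le_of_opNorm_le _ hz2 _
    calc ‖f (γ z.2 + z.1) - f (γ z.2) - fderiv ℝ f (γ z.2) z.1‖
        = ‖(f (γ z.2 + z.1) - f (γ z.2) - fderiv ℝ f (γ t) z.1) -
            (fderiv ℝ f (γ z.2) - fderiv ℝ f (γ t)) z.1‖ := by
          congr 1; simp only [_root_.sub_apply]; abel
      _ ≤ c / 2 * ‖z.1‖ + c / 2 * ‖z.1‖ := (norm_sub_le _ _).trans (add_le_add hz1 hz3)
      _ = c * ‖z.1‖ := by ring
  obtain ⟨δ, hδ, hball⟩ := Metric.eventually_nhds_iff.1 key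
  have hopen : ∀ᶠ h : C(X, F) in 𝓝 0, ∀ t, (γ + h) t ∈ U := by
    have h0 : Tendsto (fun h : C(X, F) ↦ γ + h) (𝓝 0) (𝓝 γ) := by
      simpa using (continuous_const_add γ).tendsto (0 : C(X, F))
    exact h0.eventually ((isOpen_setOf_forall_mem hU).mem_nhds hγ)
  filter_upwards [hopen, Metric.ball_mem_nhds (0 : C(X, F)) hδ] with h hh hhδ
  rw [ContinuousMap.norm_le _ (by positivity)]
  intro t
  have ht : ‖h t‖ ≤ ‖h‖ := h.norm_coe_le_norm t
  have := hball (y := h t) (by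
    rw [dist_zero_right]; exact ht.trans_lt (by simpa using hhδ)) t (mem_univ t)
  simp only [ContinuousMap.sub_apply, pointwiseApply_apply]
  rw [postcomp_apply hf.continuousOn hh, postcomp_apply hf.continuousOn hγ, postcomp_apply hD hγ]
  exact this.trans (by gcongr)

/-- The superposition operator of a smooth map is smooth. -/
theorem contDiffOn_postcomp {f : F → G} {U : Set F} (hU : IsOpen U) (hf : ContDiffOn ℝ ∞ f U) :
    ContDiffOn ℝ ∞ (postcomp f) {γ : C(X, F) | ∀ t, γ t ∈ U} := by
  rw [contDiffOn_infty]
  intro n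
  -- The derivative is governed by superposition with `fderiv ℝ f`, valued in `F →L[ℝ] G`; hence `G`
  -- varies in the induction and shares its universe with `F`.
  induction n generalizing G with
  | zero =>
    rw [Nat.cast_zero, contDiffOn_zero]
    exact fun γ hγ ↦ (hasFDerivAt_postcomp hU (hf.of_le (by simp)) hγ).continuousAt.continuousWithinAt
  | succ n ih =>
    have hD := fun γ (hγ : γ ∈ {γ : C(X, F) | ∀ t, γ t ∈ U}) ↦
      hasFDerivAt_postcomp (X := X) hU (hf.of_le (by simp)) hγ
    rw [Nat.cast_succ, contDiffOn_succ_iff_fderiv_of_isOpen (isOpen_setOf_forall_mem hU)]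
    refine ⟨fun γ hγ ↦ (hD γ hγ).differentiableAt.differentiableWithinAt, by simp, ?_⟩
    have := ih (hf.fderiv_of_isOpen hU (m := ∞) (by simp))
    have h2 := (pointwiseApply X F G).contDiff.comp_contDiffOn this
    exact h2.congr fun γ hγ ↦ (hD γ hγ).fderiv

end Superposition

/-! ### Integration of curves, time-dependent superposition and integrals with parameters. -/

section Volterra

open MeasureTheory unitInterval

universe u

variable {E G : Type u} [NormedAddCommGroup E]

theorem continuous_comp_projIcc (γ : C(I, E)) :
    Continuous fun τ : ℝ ↦ γ (projIcc 0 1 zero_le_one τ) :=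
  γ.continuous.comp continuous_projIcc

variable [NormedSpace ℝ E] [NormedAddCommGroup G] [NormedSpace ℝ G]

theorem norm_integral_comp_projIcc_le (γ : C(I, E)) (t : I) :
    ‖∫ τ in (0 : ℝ)..t, γ (projIcc 0 1 zero_le_one τ)‖ ≤ ‖γ‖ := by
  have := intervalIntegral.norm_integral_le_of_norm_le_const (a := 0) (b := (t : ℝ))
    (f := fun τ ↦ γ (projIcc 0 1 zero_le_one τ)) (C := ‖γ‖) (fun x _ ↦ γ.norm_coe_le_norm _)
  refine this.trans ?_
  have ht : |(t : ℝ) - 0| ≤ 1 := by rw [sub_zero, abs_of_nonneg t.2.1]; exact t.2.2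
  exact mul_le_of_le_one_right (norm_nonneg _) ht

variable (E) in
/-- The operator of integration from `0`, on continuous curves defined on the unit interval. -/
noncomputable def volterra : C(I, E) →L[ℝ] C(I, E) :=
  LinearMap.mkContinuous
    { toFun := fun γ ↦ ⟨fun t ↦ ∫ τ in (0 : ℝ)..t, γ (projIcc 0 1 zero_le_one τ),
        (intervalIntegral.continuous_primitive
          (fun _ _ ↦ (continuous_comp_projIcc γ).intervalIntegrable _ _) 0).comp
            continuous_subtype_val⟩
      map_add' := fun γ δ ↦ by
        ext t
        exact intervalIntegral.integral_add ((continuous_comp_projIcc γ).intervalIntegrable _ _)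
          ((continuous_comp_projIcc δ).intervalIntegrable _ _)
      map_smul' := fun c γ ↦ by
        ext t
        exact intervalIntegral.integral_smul c _ } 1
    (fun γ ↦ by
      rw [ContinuousMap.norm_le _ (by positivity), one_mul]
      exact norm_integral_comp_projIcc_le γ)

theorem volterra_apply (γ : C(I, E)) (t : I) :
    volterra E γ t = ∫ τ in (0 : ℝ)..t, γ (projIcc 0 1 zero_le_one τ) := rfl

theorem hasDerivAt_volterra [CompleteSpace E] (γ : C(I, E)) (t : I) :
    HasDerivAt (fun τ : ℝ ↦ ∫ τ' in (0 : ℝ)..τ, γ (projIcc 0 1 zero_le_one τ')) (γ t) t := by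
  have h := continuous_comp_projIcc γ
  have := intervalIntegral.integral_hasDerivAt_right (h.intervalIntegrable 0 (t : ℝ))
    (h.stronglyMeasurableAtFilter _ _) h.continuousAt
  simpa using this

variable (E) in
/-- The constant curves. -/
noncomputable def constCurve : E →L[ℝ] C(I, E) :=
  LinearMap.mkContinuous
    { toFun := ContinuousMap.const I
      map_add' := fun _ _ ↦ rfl
      map_smul' := fun _ _ ↦ rfl } 1
    (fun x ↦ by
      rw [ContinuousMap.norm_le _ (by positivity), one_mul]
      exact fun _ ↦ le_rfl)

@[simp]
theorem constCurve_apply (x : E) (t : I) : constCurve E x t = x := rfl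

/-- The graph `t ↦ (t, γ t)` of a curve `γ`. -/
def graphCurve (γ : C(I, E)) : C(I, ℝ × E) :=
  ⟨fun t ↦ ((t : ℝ), γ t), by fun_prop⟩

@[simp]
theorem graphCurve_apply (γ : C(I, E)) (t : I) : graphCurve γ t = ((t : ℝ), γ t) := rfl

variable (E) in
/-- The derivative of `graphCurve`. -/
noncomputable def inrCurve : C(I, E) →L[ℝ] C(I, ℝ × E) :=
  (ContinuousLinearMap.inr ℝ ℝ E).compLeftContinuous ℝ I

@[simp]
theorem inrCurve_apply (γ : C(I, E)) (t : I) : inrCurve E γ t = (0, γ t) := rfl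

theorem graphCurve_eq (γ : C(I, E)) : graphCurve γ = graphCurve 0 + inrCurve E γ := by
  ext t <;> simp

theorem contDiff_graphCurve : ContDiff ℝ ∞ (graphCurve : C(I, E) → C(I, ℝ × E)) := by
  rw [funext graphCurve_eq]
  exact contDiff_const.add (inrCurve E).contDiff

theorem hasFDerivAt_graphCurve (γ : C(I, E)) :
    HasFDerivAt (graphCurve : C(I, E) → C(I, ℝ × E)) (inrCurve E) γ := by
  rw [funext graphCurve_eq]
  exact (inrCurve E).hasFDerivAt.const_add _

/-- The superposition operator of a time-dependent map. -/
noncomputable def timePostcomp (f : ℝ × E → G) (γ : C(I, E)) : C(I, G) :=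
  postcomp f (graphCurve γ)

variable {f : ℝ × E → G} {U : Set (ℝ × E)}

theorem isOpen_setOf_graph_mem (hU : IsOpen U) :
    IsOpen {γ : C(I, E) | ∀ t : I, ((t : ℝ), γ t) ∈ U} :=
  (isOpen_setOf_forall_mem hU).preimage (contDiff_graphCurve (E := E)).continuous

theorem timePostcomp_apply (hf : ContinuousOn f U) {γ : C(I, E)}
    (hγ : ∀ t : I, ((t : ℝ), γ t) ∈ U) (t : I) : timePostcomp f γ t = f (t, γ t) :=
  postcomp_apply hf (γ := graphCurve γ) hγ t

theorem contDiffOn_timePostcomp (hU : IsOpen U) (hf : ContDiffOn ℝ ∞ f U) :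
    ContDiffOn ℝ ∞ (timePostcomp f) {γ : C(I, E) | ∀ t : I, ((t : ℝ), γ t) ∈ U} :=
  (contDiffOn_postcomp hU hf).comp contDiff_graphCurve.contDiffOn fun _ h ↦ h

theorem fderiv_timePostcomp_apply (hU : IsOpen U) (hf : ContDiffOn ℝ ∞ f U) {γ : C(I, E)}
    (hγ : ∀ t : I, ((t : ℝ), γ t) ∈ U) (δ : C(I, E)) (t : I) :
    fderiv ℝ (timePostcomp f) γ δ t = fderiv ℝ f (t, γ t) (0, δ t) := by
  have hf1 : ContDiffOn ℝ 1 f U := hf.of_le (by simp)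
  have h := (hasFDerivAt_postcomp hU hf1 (γ := graphCurve γ) hγ).comp γ (hasFDerivAt_graphCurve γ)
  rw [show timePostcomp f = postcomp f ∘ graphCurve from rfl, h.fderiv]
  simp only [ContinuousLinearMap.comp_apply, pointwiseApply_apply, inrCurve_apply]
  rw [postcomp_apply (hf1.continuousOn_fderiv_of_isOpen hU le_rfl) hγ]
  rfl

/-- This writes a parameter integral as a superposition operator between continuous linear maps, so
smoothness in `x` and differentiation under the integral follow from the chain rule. -/
theorem integral_eq_volterra (hf : ContinuousOn f U) {x : E}
    (hx : ∀ t ∈ Icc (0 : ℝ) 1, (t, x) ∈ U) :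
    ∫ t in (0 : ℝ)..1, f (t, x) = volterra G (timePostcomp f (constCurve E x)) 1 := by
  rw [volterra_apply]
  refine intervalIntegral.integral_congr fun t ht ↦ ?_
  rw [uIcc_of_le (by simp)] at ht
  have := timePostcomp_apply hf (γ := constCurve E x) (fun t ↦ hx t t.2)
    (projIcc 0 1 zero_le_one t)
  rw [this, projIcc_of_mem zero_le_one ht]
  rfl

/-- Smoothness of integrals depending on a parameter. -/
theorem contDiffOn_integral_param (hU : IsOpen U) (hf : ContDiffOn ℝ ∞ f U) {V : Set E}
    (hV : ∀ x ∈ V, ∀ t ∈ Icc (0 : ℝ) 1, (t, x) ∈ U) :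
    ContDiffOn ℝ ∞ (fun x ↦ ∫ t in (0 : ℝ)..1, f (t, x)) V := by
  have h1 := (contDiffOn_timePostcomp hU hf).comp (constCurve E).contDiff.contDiffOn (s := V)
    (fun x hx t ↦ hV x hx t t.2)
  have h2 := ((ContinuousMap.evalCLM ℝ (1 : I)).comp (volterra G)).contDiff.comp_contDiffOn h1
  exact h2.congr fun x hx ↦ integral_eq_volterra hf.continuousOn (hV x hx)

/-- Differentiation under the integral sign. -/
theorem fderiv_integral_param_apply (hU : IsOpen U) (hf : ContDiffOn ℝ ∞ f U) {V : Set E}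
    (hVo : IsOpen V) (hV : ∀ x ∈ V, ∀ t ∈ Icc (0 : ℝ) 1, (t, x) ∈ U) {x : E} (hx : x ∈ V)
    (v : E) :
    fderiv ℝ (fun x ↦ ∫ t in (0 : ℝ)..1, f (t, x)) x v =
      ∫ t in (0 : ℝ)..1, fderiv ℝ f (t, x) (0, v) := by
  have hmem : ∀ t : I, ((t : ℝ), constCurve E x t) ∈ U := fun t ↦ hV x hx t t.2
  have hN := ((contDiffOn_timePostcomp hU hf).contDiffAt
    ((isOpen_setOf_graph_mem hU).mem_nhds hmem)).differentiableAt (by simp)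
  have hd := ((ContinuousMap.evalCLM ℝ (1 : I)).comp (volterra G)).hasFDerivAt.comp x
    (hN.hasFDerivAt.comp x (constCurve E).hasFDerivAt)
  have heq : (fun x ↦ ∫ t in (0 : ℝ)..1, f (t, x)) =ᶠ[𝓝 x]
      ((ContinuousMap.evalCLM ℝ (1 : I)).comp (volterra G)) ∘
        (timePostcomp f ∘ constCurve E) := by
    filter_upwards [hVo.mem_nhds hx] with y hy
    exact integral_eq_volterra hf.continuousOn (hV y hy)
  rw [(hd.congr_of_eventuallyEq heq).fderiv]
  change volterra G (fderiv ℝ (timePostcomp f) (constCurve E x) (constCurve E v)) 1 = _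
  rw [volterra_apply]
  refine intervalIntegral.integral_congr fun t ht ↦ ?_
  rw [uIcc_of_le (by simp)] at ht
  rw [fderiv_timePostcomp_apply hU hf hmem, projIcc_of_mem zero_le_one ht]
  rfl

end Volterra

/-! ### Smooth flows near a rest point, and the Poincaré lemma by radial homotopy. -/

section Darboux

open MeasureTheory unitInterval

universe u

variable {E : Type u} [NormedAddCommGroup E] [NormedSpace ℝ E]

/-- The integral curves on `[0, 1]` of a time-dependent vector field that vanishes to first order at
`0` depend smoothly on their starting point near `0`. -/
theorem exists_smooth_flow [CompleteSpace E] {X : ℝ × E → E} {W : Set (ℝ × E)} (hW : IsOpen W)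
    (hX : ContDiffOn ℝ ∞ X W) (h0 : ∀ t ∈ Icc (0 : ℝ) 1, (t, (0 : E)) ∈ W)
    (hX0 : ∀ t ∈ Icc (0 : ℝ) 1, X (t, 0) = 0)
    (hX' : ∀ t ∈ Icc (0 : ℝ) 1, ∀ v : E, fderiv ℝ X (t, 0) (0, v) = 0) :
    ∃ (V : Set E) (Γ : E → C(I, E)), IsOpen V ∧ (0 : E) ∈ V ∧ ContDiffOn ℝ ∞ Γ V ∧ Γ 0 = 0 ∧
      ∀ x ∈ V, (∀ t : I, ((t : ℝ), Γ x t) ∈ W) ∧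
        Γ x = constCurve E x + volterra E (timePostcomp X (Γ x)) := by
  set 𝒰 : Set C(I, E) := {γ | ∀ t : I, ((t : ℝ), γ t) ∈ W}
  have h𝒰 : IsOpen 𝒰 := isOpen_setOf_graph_mem hW
  have h0𝒰 : (0 : C(I, E)) ∈ 𝒰 := fun t ↦ h0 t t.2
  -- The integral curve from `x` is the solution of `F γ = constCurve E x`. Since the field and its
  -- space derivative vanish at `0`, `F` has derivative the identity at the zero curve, and
  -- inverting it gives existence up to time `1` together with smooth dependence.
  set F : C(I, E) → C(I, E) := fun γ ↦ γ - volterra E (timePostcomp X γ)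
  have hN := contDiffOn_timePostcomp hW hX
  have hF : ContDiffOn ℝ ∞ F 𝒰 := contDiffOn_id.sub ((volterra E).contDiff.comp_contDiffOn hN)
  have hN0 : fderiv ℝ (timePostcomp X) (0 : C(I, E)) = 0 := by
    ext δ t
    rw [fderiv_timePostcomp_apply hW hX h0𝒰]
    exact hX' t t.2 _
  have hF' : HasFDerivAt F ((ContinuousLinearEquiv.refl ℝ C(I, E) : C(I, E) ≃L[ℝ] C(I, E)) :
      C(I, E) →L[ℝ] C(I, E)) 0 := by
    have hd := ((hN.contDiffAt (h𝒰.mem_nhds h0𝒰)).differentiableAt (by simp)).hasFDerivAt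
    have := (hasFDerivAt_id (0 : C(I, E))).sub ((volterra E).hasFDerivAt.comp _ hd)
    rw [hN0, ContinuousLinearMap.comp_zero, sub_zero] at this
    exact this
  obtain ⟨H, h0H, hH𝒰, hHF, hHs⟩ := exists_openPartialHomeomorph_of_contDiffOn h𝒰 hF h0𝒰 _ hF'
  have hF0 : F 0 = 0 := by
    have : timePostcomp X (0 : C(I, E)) = 0 := by
      ext t
      rw [timePostcomp_apply hX.continuousOn h0𝒰]
      exact hX0 t t.2
    simp [F, this]
  have hH0 : H 0 = 0 := by rw [hHF, hF0]
  refine ⟨constCurve E ⁻¹' H.target, fun x ↦ H.symm (constCurve E x),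
    H.open_target.preimage (constCurve E).continuous, ?_, ?_, ?_, fun x hx ↦ ⟨?_, ?_⟩⟩
  · change constCurve E 0 ∈ H.target
    rw [map_zero, ← hH0]
    exact H.map_source h0H
  · exact hHs.comp (constCurve E).contDiff.contDiffOn fun _ h ↦ h
  · change H.symm (constCurve E 0) = 0
    rw [map_zero]
    nth_rewrite 1 [← hH0]
    exact H.left_inv h0H
  · exact hH𝒰 (H.map_target hx)
  · have := H.right_inv hx
    rw [hHF] at this
    exact sub_eq_iff_eq_add.1 this

/-- The derivative of the flow solves the linearized equation. -/
theorem fderiv_flow_eq {X : ℝ × E → E} {W : Set (ℝ × E)} (hW : IsOpen W)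
    (hX : ContDiffOn ℝ ∞ X W) {V : Set E} (hV : IsOpen V) {Γ : E → C(I, E)}
    (hΓ : ContDiffOn ℝ ∞ Γ V) (hΓW : ∀ x ∈ V, ∀ t : I, ((t : ℝ), Γ x t) ∈ W)
    (heq : ∀ x ∈ V, Γ x = constCurve E x + volterra E (timePostcomp X (Γ x)))
    {x : E} (hx : x ∈ V) (a : E) :
    fderiv ℝ Γ x a = constCurve E a +
      volterra E (fderiv ℝ (timePostcomp X) (Γ x) (fderiv ℝ Γ x a)) := by
  have hΓx := ((hΓ.contDiffAt (hV.mem_nhds hx)).differentiableAt (by simp)).hasFDerivAt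
  have hN := ((contDiffOn_timePostcomp hW hX).contDiffAt
    ((isOpen_setOf_graph_mem hW).mem_nhds (hΓW x hx))).differentiableAt (by simp)
  have hd := (constCurve E).hasFDerivAt.add ((volterra E).hasFDerivAt.comp x
    (hN.hasFDerivAt.comp x hΓx))
  have h2 := hd.congr_of_eventuallyEq (f₁ := Γ)
    (by filter_upwards [hV.mem_nhds hx] with y hy using heq y hy)
  conv_lhs => rw [h2.fderiv]
  rfl

variable {η : E → E →L[ℝ] E →L[ℝ] ℝ} {r : ℝ}

/-- The primitive of `η - η 0` given by the radial homotopy. -/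
noncomputable def radialPrimitive (η : E → E →L[ℝ] E →L[ℝ] ℝ) (x : E) : E →L[ℝ] ℝ :=
  ∫ s in (0 : ℝ)..1, s • ((η (s • x) - η 0) x)

theorem isOpen_setOf_smul_mem_ball :
    IsOpen {p : ℝ × E | p.1 • p.2 ∈ Metric.ball (0 : E) r} :=
  Metric.isOpen_ball.preimage (continuous_fst.smul continuous_snd)

theorem smul_mem_ball_of_mem_Icc {x : E} (hx : x ∈ Metric.ball (0 : E) r) {t : ℝ}
    (ht : t ∈ Icc (0 : ℝ) 1) : t • x ∈ Metric.ball (0 : E) r := by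
  rw [mem_ball_zero_iff] at hx ⊢
  rw [norm_smul, Real.norm_of_nonneg ht.1]
  exact (mul_le_of_le_one_left (norm_nonneg _) ht.2).trans_lt hx

theorem contDiffOn_radialIntegrand (hη : ContDiffOn ℝ ∞ η (Metric.ball 0 r)) :
    ContDiffOn ℝ ∞ (fun p : ℝ × E ↦ p.1 • ((η (p.1 • p.2) - η 0) p.2))
      {p : ℝ × E | p.1 • p.2 ∈ Metric.ball (0 : E) r} := by
  have h1 : ContDiff ℝ ∞ (fun p : ℝ × E ↦ p.1 • p.2) := contDiff_fst.smul contDiff_snd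
  have h2 := hη.comp h1.contDiffOn (s := {p : ℝ × E | p.1 • p.2 ∈ Metric.ball (0 : E) r})
    fun _ h ↦ h
  exact contDiff_fst.contDiffOn.smul
    ((h2.sub contDiffOn_const).clm_apply contDiff_snd.contDiffOn)

theorem contDiffOn_radialPrimitive (hη : ContDiffOn ℝ ∞ η (Metric.ball 0 r)) :
    ContDiffOn ℝ ∞ (radialPrimitive η) (Metric.ball 0 r) :=
  contDiffOn_integral_param isOpen_setOf_smul_mem_ball (contDiffOn_radialIntegrand hη)
    fun _ hx _ ht ↦ smul_mem_ball_of_mem_Icc hx ht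

theorem fderiv_radialIntegrand (hη : ContDiffOn ℝ ∞ η (Metric.ball 0 r)) {s : ℝ} {x : E}
    (hx : s • x ∈ Metric.ball (0 : E) r) (a : E) :
    fderiv ℝ (fun p : ℝ × E ↦ p.1 • ((η (p.1 • p.2) - η 0) p.2)) (s, x) (0, a) =
      s • (s • fderiv ℝ η (s • x) a x + (η (s • x) - η 0) a) := by
  have hηx := ((hη.contDiffAt (Metric.isOpen_ball.mem_nhds hx)).differentiableAt
    (by simp)).hasFDerivAt
  have h1 : HasFDerivAt (fun y : E ↦ s • ((η (s • y) - η 0) y)) _ x :=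
    (((hηx.comp x ((hasFDerivAt_id x).const_smul s)).sub_const (η 0)).clm_apply
      (hasFDerivAt_id x)).const_smul s
  have h2 := (((contDiffOn_radialIntegrand hη).contDiffAt
    (isOpen_setOf_smul_mem_ball.mem_nhds (show (s, x) ∈ _ from hx))).differentiableAt
    (by simp)).hasFDerivAt
  have h3 := h2.comp x (hasFDerivAt_prodMk_right s x)
  have h4 := h3.unique h1
  have h5 := congrArg (fun L : E →L[ℝ] (E →L[ℝ] ℝ) ↦ L a) h4
  simp only [ContinuousLinearMap.comp_apply, ContinuousLinearMap.inr_apply] at h5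
  rw [h5]
  ext b
  simp
  ring

theorem fderiv_radialPrimitive_apply [CompleteSpace E] (hη : ContDiffOn ℝ ∞ η (Metric.ball 0 r))
    {x : E} (hx : x ∈ Metric.ball (0 : E) r) (a : E) :
    fderiv ℝ (radialPrimitive η) x a =
      ∫ s in (0 : ℝ)..1, s • (s • fderiv ℝ η (s • x) a x + (η (s • x) - η 0) a) := by
  have := fderiv_integral_param_apply isOpen_setOf_smul_mem_ball (contDiffOn_radialIntegrand hη)
    Metric.isOpen_ball (fun _ hx _ ht ↦ smul_mem_ball_of_mem_Icc hx ht) hx a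
  refine this.trans (intervalIntegral.integral_congr fun s hs ↦ ?_)
  rw [uIcc_of_le zero_le_one] at hs
  exact fderiv_radialIntegrand hη (smul_mem_ball_of_mem_Icc hx hs) a

/-- The Poincaré lemma for the closed form `η - η 0`. -/
theorem fderiv_radialPrimitive_sub [CompleteSpace E] (hη : ContDiffOn ℝ ∞ η (Metric.ball 0 r))
    (halt : ∀ x ∈ Metric.ball (0 : E) r, ∀ a b, η x a b = -η x b a)
    (hcl : ∀ x ∈ Metric.ball (0 : E) r, ∀ a b c,
      fderiv ℝ η x a b c - fderiv ℝ η x b a c + fderiv ℝ η x c a b = 0)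
    {x : E} (hx : x ∈ Metric.ball (0 : E) r) (a b : E) :
    fderiv ℝ (radialPrimitive η) x a b - fderiv ℝ (radialPrimitive η) x b a =
      η x a b - η 0 a b := by
  have h0 : (0 : E) ∈ Metric.ball (0 : E) r := by
    simpa using smul_mem_ball_of_mem_Icc hx (t := 0) (by simp)
  have hmaps : MapsTo (fun s : ℝ ↦ s • x) (Icc 0 1) (Metric.ball (0 : E) r) :=
    fun s hs ↦ smul_mem_ball_of_mem_Icc hx hs
  have hsc : ContinuousOn (fun s : ℝ ↦ s • x) (Icc 0 1) := by fun_prop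
  have hc1 : ∀ a : E, ContinuousOn (fun s : ℝ ↦ fderiv ℝ η (s • x) a) (Icc 0 1) := fun a ↦
    ((hη.continuousOn_fderiv_of_isOpen Metric.isOpen_ball (by simp)).comp hsc hmaps).clm_apply
      continuousOn_const
  have hc2 : ContinuousOn (fun s : ℝ ↦ η (s • x)) (Icc 0 1) :=
    hη.continuousOn.comp hsc hmaps
  have hint : ∀ a : E, ContinuousOn (fun s : ℝ ↦
      s • (s • fderiv ℝ η (s • x) a x + (η (s • x) - η 0) a)) (uIcc 0 1) := by
    intro a
    rw [uIcc_of_le zero_le_one]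
    exact continuousOn_id.smul ((continuousOn_id.smul ((hc1 a).clm_apply continuousOn_const)).add
      ((hc2.clm_apply continuousOn_const).sub continuousOn_const))
  have happ : ∀ a b : E, fderiv ℝ (radialPrimitive η) x a b = ∫ s in (0 : ℝ)..1,
      s * (s * fderiv ℝ η (s • x) a x b + (η (s • x) a b - η 0 a b)) := by
    intro a b
    rw [fderiv_radialPrimitive_apply hη hx, ContinuousLinearMap.intervalIntegral_apply
      ((hint a).intervalIntegrable)]
    rfl
  have hint' : ∀ a b : E, IntervalIntegrable (fun s : ℝ ↦
      s * (s * fderiv ℝ η (s • x) a x b + (η (s • x) a b - η 0 a b))) volume 0 1 := by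
    intro a b
    exact ((hint a).clm_apply continuousOn_const).intervalIntegrable
  rw [happ, happ, ← intervalIntegral.integral_sub (hint' a b) (hint' b a)]
  -- Closedness on the triple `x, a, b` and antisymmetry turn the difference of the integrands into
  -- an exact derivative in `s`.
  have hderiv : ∀ s ∈ uIcc (0 : ℝ) 1, HasDerivAt (fun s : ℝ ↦ s ^ 2 * (η (s • x) a b - η 0 a b))
      (s * (s * fderiv ℝ η (s • x) a x b + (η (s • x) a b - η 0 a b)) -
        s * (s * fderiv ℝ η (s • x) b x a + (η (s • x) b a - η 0 b a))) s := by
    intro s hs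
    rw [uIcc_of_le zero_le_one] at hs
    have hηx := ((hη.contDiffAt (Metric.isOpen_ball.mem_nhds (hmaps hs))).differentiableAt
      (by simp)).hasFDerivAt
    have h1 : HasDerivAt (fun s : ℝ ↦ s • x) x s := by
      simpa using (hasDerivAt_id s).smul_const x
    have h2 := hηx.comp_hasDerivAt s h1
    have h3 : HasDerivAt (fun s : ℝ ↦ η (s • x) a b) (fderiv ℝ η (s • x) x a b) s := by
      have := (h2.clm_apply (hasDerivAt_const s a)).clm_apply (hasDerivAt_const s b)
      simpa using this
    have h4 := (hasDerivAt_pow 2 s).mul (h3.sub_const (η 0 a b))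
    refine h4.congr_deriv ?_
    have c1 := hcl _ (hmaps hs) x a b
    have c2 := halt _ (hmaps hs) b a
    have c3 := halt _ h0 b a
    simp only at c1 c2
    rw [c2, c3]
    simp only [Nat.cast_ofNat, Nat.add_one_sub_one, pow_one]
    linear_combination s ^ 2 * c1
  rw [intervalIntegral.integral_eq_sub_of_hasDerivAt hderiv
    ((hint' a b).sub (hint' b a))]
  simp

end Darboux

/-! ### Moser's vector field and its infinitesimal identity. -/

section Moser

open MeasureTheory unitInterval

universe u

variable {E : Type u} [NormedAddCommGroup E] [NormedSpace ℝ E]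

/-- The interpolation `η 0 + t (η y - η 0)` between a constant form and a given one. -/
noncomputable def interpolatedForm (η : E → E →L[ℝ] E →L[ℝ] ℝ) (p : ℝ × E) : E →L[ℝ] E →L[ℝ] ℝ :=
  η 0 + p.1 • (η p.2 - η 0)

/-- The time-dependent vector field of Moser's argument. -/
noncomputable def moserField (η : E → E →L[ℝ] E →L[ℝ] ℝ) (p : ℝ × E) : E :=
  -(interpolatedForm η p).inverse (radialPrimitive η p.2)

/-- The set of the `(t, y)` such that `y` lies in the ball and the interpolated form is nondegenerate
at `(t, y)`. -/
def moserDomain (η : E → E →L[ℝ] E →L[ℝ] ℝ) (r : ℝ) : Set (ℝ × E) :=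
  Prod.snd ⁻¹' Metric.ball 0 r ∩ interpolatedForm η ⁻¹'
    range (ContinuousLinearEquiv.toContinuousLinearMap :
      (E ≃L[ℝ] (E →L[ℝ] ℝ)) → (E →L[ℝ] (E →L[ℝ] ℝ)))

variable {η : E → E →L[ℝ] E →L[ℝ] ℝ} {r : ℝ}

theorem contDiffOn_interpolatedForm (hη : ContDiffOn ℝ ∞ η (Metric.ball 0 r)) :
    ContDiffOn ℝ ∞ (interpolatedForm η) (Prod.snd ⁻¹' Metric.ball 0 r) :=
  contDiffOn_const.add (contDiff_fst.contDiffOn.smul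
    ((hη.comp contDiff_snd.contDiffOn fun _ h ↦ h).sub contDiffOn_const))

theorem isOpen_moserDomain [CompleteSpace E] (hη : ContDiffOn ℝ ∞ η (Metric.ball 0 r)) :
    IsOpen (moserDomain η r) :=
  (contDiffOn_interpolatedForm hη).continuousOn.isOpen_inter_preimage
    (Metric.isOpen_ball.preimage continuous_snd) ContinuousLinearEquiv.isOpen

theorem contDiffOn_moserField [CompleteSpace E] (hη : ContDiffOn ℝ ∞ η (Metric.ball 0 r)) :
    ContDiffOn ℝ ∞ (moserField η) (moserDomain η r) := by
  have h1 : ContDiffOn ℝ ∞ (fun p ↦ (interpolatedForm η p).inverse) (moserDomain η r) := by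
    intro p hp
    obtain ⟨e, he⟩ := hp.2
    have := contDiffAt_map_inverse (n := ∞) e
    rw [he] at this
    exact this.comp_contDiffWithinAt p
      ((contDiffOn_interpolatedForm hη).mono inter_subset_left p hp)
  exact (h1.clm_apply ((contDiffOn_radialPrimitive hη).comp contDiff_snd.contDiffOn
    fun _ h ↦ h.1)).neg

theorem interpolatedForm_moserField {p : ℝ × E} (hp : p ∈ moserDomain η r) :
    interpolatedForm η p (moserField η p) = -radialPrimitive η p.2 := by
  obtain ⟨e, he⟩ := hp.2
  rw [moserField, map_neg, ← he, ContinuousLinearMap.inverse_equiv]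
  simp

theorem radialPrimitive_zero : radialPrimitive η 0 = 0 := by
  simp [radialPrimitive]

/-- Subtracting `η 0` in the homotopy formula gives this extra order of vanishing. It makes the
space derivative of Moser's field vanish at `0`, as `exists_smooth_flow` demands. -/
theorem fderiv_radialPrimitive_zero [CompleteSpace E] (hη : ContDiffOn ℝ ∞ η (Metric.ball 0 r))
    (hr : 0 < r) : fderiv ℝ (radialPrimitive η) 0 = 0 := by
  ext1 a
  rw [fderiv_radialPrimitive_apply hη (Metric.mem_ball_self hr)]
  simp

theorem fderiv_moserField_zero [CompleteSpace E] (hη : ContDiffOn ℝ ∞ η (Metric.ball 0 r))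
    (hr : 0 < r) {t : ℝ} (ht : (t, (0 : E)) ∈ moserDomain η r) (v : E) :
    fderiv ℝ (moserField η) (t, 0) (0, v) = 0 := by
  obtain ⟨e, he⟩ := ht.2
  have h1 : DifferentiableAt ℝ (fun p ↦ (interpolatedForm η p).inverse) (t, (0 : E)) := by
    have := (contDiffAt_map_inverse (n := ∞) e).differentiableAt (by simp)
    rw [he] at this
    exact this.comp _ (((contDiffOn_interpolatedForm hη).contDiffAt
      ((Metric.isOpen_ball.preimage continuous_snd).mem_nhds ht.1)).differentiableAt (by simp))
  have h2 : HasFDerivAt (fun p : ℝ × E ↦ radialPrimitive η p.2)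
      (0 : ℝ × E →L[ℝ] (E →L[ℝ] ℝ)) (t, 0) := by
    have h3 := (((contDiffOn_radialPrimitive hη).contDiffAt
      (Metric.isOpen_ball.mem_nhds (Metric.mem_ball_self hr))).differentiableAt
      (by simp)).hasFDerivAt
    rw [fderiv_radialPrimitive_zero hη hr] at h3
    have h5 := h3.comp (t, (0 : E)) (hasFDerivAt_snd (𝕜 := ℝ) (p := (t, (0 : E))))
    rw [ContinuousLinearMap.zero_comp] at h5
    exact h5
  have h4 := (h1.hasFDerivAt.clm_apply h2).neg
  have h6 : fderiv ℝ (moserField η) (t, 0) = _ := h4.fderiv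
  rw [h6]
  simp [radialPrimitive_zero]

/-- The derivative of the equation which defines the field of Moser's argument. -/
theorem fderiv_moserField_eq [CompleteSpace E] (hη : ContDiffOn ℝ ∞ η (Metric.ball 0 r))
    {t : ℝ} {y : E} (hp : (t, y) ∈ moserDomain η r) (v w : E) :
    t * fderiv ℝ η y v (moserField η (t, y)) w +
        interpolatedForm η (t, y) (fderiv ℝ (moserField η) (t, y) (0, v)) w =
      -fderiv ℝ (radialPrimitive η) y v w := by
  have hy : y ∈ Metric.ball (0 : E) r := hp.1
  have hD := isOpen_moserDomain hη
  have hηy := ((hη.contDiffAt (Metric.isOpen_ball.mem_nhds hy)).differentiableAt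
    (by simp)).hasFDerivAt
  have hσ := (((contDiffOn_radialPrimitive hη).contDiffAt
      (Metric.isOpen_ball.mem_nhds hy)).differentiableAt (by simp)).hasFDerivAt
  have hX := ((((contDiffOn_moserField hη).contDiffAt (hD.mem_nhds hp)).differentiableAt
    (by simp)).hasFDerivAt).comp y (hasFDerivAt_prodMk_right t y)
  have hform : HasFDerivAt (fun z ↦ interpolatedForm η (t, z)) (t • fderiv ℝ η y) y :=
    ((hηy.sub_const (η 0)).const_smul t).const_add (η 0)
  have h1 := (hform.clm_apply hX)
  have h2 : (fun z ↦ interpolatedForm η (t, z) (moserField η (t, z))) =ᶠ[𝓝 y]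
      fun z ↦ -radialPrimitive η z := by
    have hcont : ContinuousAt (fun z : E ↦ (t, z)) y := by fun_prop
    filter_upwards [hcont.preimage_mem_nhds (hD.mem_nhds hp)] with z hz
    exact interpolatedForm_moserField hz
  have h3 := h1.unique (hσ.neg.congr_of_eventuallyEq h2)
  have h4 := congrArg (fun L : E →L[ℝ] (E →L[ℝ] ℝ) ↦ L v w) h3
  simp at h4
  linarith

/-- The infinitesimal form of Moser's argument. -/
theorem moser_identity [CompleteSpace E] (hη : ContDiffOn ℝ ∞ η (Metric.ball 0 r))
    (halt : ∀ x ∈ Metric.ball (0 : E) r, ∀ a b, η x a b = -η x b a)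
    (hcl : ∀ x ∈ Metric.ball (0 : E) r, ∀ a b c,
      fderiv ℝ η x a b c - fderiv ℝ η x b a c + fderiv ℝ η x c a b = 0)
    {t : ℝ} {y : E} (hp : (t, y) ∈ moserDomain η r) (v w : E) :
    (η y v w - η 0 v w) + t * fderiv ℝ η y (moserField η (t, y)) v w +
        interpolatedForm η (t, y) (fderiv ℝ (moserField η) (t, y) (0, v)) w +
        interpolatedForm η (t, y) v (fderiv ℝ (moserField η) (t, y) (0, w)) = 0 := by
  have hy : y ∈ Metric.ball (0 : E) r := hp.1
  have h0 : (0 : E) ∈ Metric.ball (0 : E) r := by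
    simpa using smul_mem_ball_of_mem_Icc hy (t := 0) (by simp)
  -- The difference of `e1` and `e2` computes minus the exterior derivative of the primitive, which
  -- `e3` equates with `η 0 - η`; closedness (`e4`) trades the remaining derivatives of `η` for the
  -- one along the field.
  have e1 := fderiv_moserField_eq hη hp v w
  have e2 := fderiv_moserField_eq hη hp w v
  have e3 := fderiv_radialPrimitive_sub hη halt hcl hy v w
  have e4 := hcl y hy (moserField η (t, y)) v w
  have e5 : ∀ a b : E, interpolatedForm η (t, y) a b = -interpolatedForm η (t, y) b a := by
    intro a b
    simp only [interpolatedForm, _root_.add_apply, _root_.smul_apply, _root_.sub_apply, smul_eq_mul]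
    rw [halt y hy a b, halt 0 h0 a b]
    ring
  have e6 : fderiv ℝ η y w (moserField η (t, y)) v = - fderiv ℝ η y w v (moserField η (t, y)) := by
    have hηy := ((hη.contDiffAt (Metric.isOpen_ball.mem_nhds hy)).differentiableAt
      (by simp)).hasFDerivAt
    have ha : ∀ a b : E, HasFDerivAt (fun z ↦ η z a b)
        (((fderiv ℝ η y).flip a).flip b) y := fun a b ↦
      (((hηy.clm_apply (hasFDerivAt_const a y)).clm_apply (hasFDerivAt_const b y))).congr_fderiv
        (by ext; simp)
    have hab := (ha (moserField η (t, y)) v).unique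
      ((ha v (moserField η (t, y))).neg.congr_of_eventuallyEq (by
        filter_upwards [Metric.isOpen_ball.mem_nhds hy] with z hz
        exact halt z hz _ _))
    have := congrArg (fun L : E →L[ℝ] ℝ ↦ L w) hab
    simpa using this
  rw [e5 v]
  rw [e6] at e4 e2
  linear_combination (exp := 1) e1 - e2 - e3 + t * e4

end Moser

/-! ### Darboux's theorem in a vector space. -/

section NormalForm

open MeasureTheory unitInterval

universe u

variable {E : Type u} [NormedAddCommGroup E] [NormedSpace ℝ E]
variable {η : E → E →L[ℝ] E →L[ℝ] ℝ} {r : ℝ}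

/-- Extending `δ` by constants beyond `[0, 1]` gives an extension of `γ` to the line with two-sided
derivatives even at the end points. -/
theorem hasDerivAt_of_eq_volterra [CompleteSpace E] {γ δ : C(I, E)} {x : E}
    (h : γ = constCurve E x + volterra E δ) :
    ∃ g : ℝ → E, (∀ t : I, g t = γ t) ∧ ∀ t : I, HasDerivAt g (δ t) t := by
  refine ⟨fun t ↦ x + ∫ τ in (0 : ℝ)..t, δ (projIcc 0 1 zero_le_one τ), fun t ↦ ?_, fun t ↦ ?_⟩
  · rw [h]; rfl
  · exact (hasDerivAt_volterra δ t).const_add x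

/-- Along the flow of Moser's field the pullback of the interpolated forms is constant. -/
theorem pullback_moser_flow [CompleteSpace E] (hη : ContDiffOn ℝ ∞ η (Metric.ball 0 r))
    (halt : ∀ x ∈ Metric.ball (0 : E) r, ∀ a b, η x a b = -η x b a)
    (hcl : ∀ x ∈ Metric.ball (0 : E) r, ∀ a b c,
      fderiv ℝ η x a b c - fderiv ℝ η x b a c + fderiv ℝ η x c a b = 0)
    {γ A B : C(I, E)} {x a b : E} (hγ : ∀ t : I, ((t : ℝ), γ t) ∈ moserDomain η r)
    (hγe : γ = constCurve E x + volterra E (timePostcomp (moserField η) γ))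
    (hA : A = constCurve E a + volterra E (fderiv ℝ (timePostcomp (moserField η)) γ A))
    (hB : B = constCurve E b + volterra E (fderiv ℝ (timePostcomp (moserField η)) γ B)) :
    η (γ 1) (A 1) (B 1) = η 0 a b := by
  have hD := isOpen_moserDomain hη
  have hX := contDiffOn_moserField hη
  obtain ⟨g, hg, hg'⟩ := hasDerivAt_of_eq_volterra hγe
  obtain ⟨gA, hgA, hgA'⟩ := hasDerivAt_of_eq_volterra hA
  obtain ⟨gB, hgB, hgB'⟩ := hasDerivAt_of_eq_volterra hB
  -- `A` and `B` solve the linearized equation, so the derivative of `q` is the left side of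
  -- `moser_identity`; the two values to be compared are `q 0` and `q 1`.
  set q : ℝ → ℝ := fun t ↦ interpolatedForm η (t, g t) (gA t) (gB t)
  have hq : ∀ t ∈ Icc (0 : ℝ) 1, HasDerivAt q 0 t := by
    intro t ht
    set τ : I := ⟨t, ht⟩
    have h1 := hg' τ
    rw [timePostcomp_apply hX.continuousOn hγ] at h1
    have h2 := hgA' τ
    rw [fderiv_timePostcomp_apply hD hX hγ, ← hgA] at h2
    have h3 := hgB' τ
    rw [fderiv_timePostcomp_apply hD hX hγ, ← hgB] at h3
    have hp := hγ τ
    rw [← hg] at h1 h2 h3 hp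
    change HasDerivAt g _ t at h1
    change HasDerivAt gA _ t at h2
    change HasDerivAt gB _ t at h3
    change (t, g t) ∈ _ at hp
    have hηy := ((hη.contDiffAt (Metric.isOpen_ball.mem_nhds hp.1)).differentiableAt
      (by simp)).hasFDerivAt
    have h4 := (((hasDerivAt_id t).smul ((hηy.comp_hasDerivAt t h1).sub_const (η 0))).const_add
      (η 0))
    have h5 := (h4.clm_apply h2).clm_apply h3
    refine h5.congr_deriv (Eq.trans ?_ (moser_identity hη halt hcl hp (gA t) (gB t)))
    simp [interpolatedForm, τ]
    ring
  have hconst := constant_of_has_deriv_right_zero (f := q) (a := 0) (b := 1)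
    (fun t ht ↦ (hq t ht).continuousAt.continuousWithinAt)
    (fun t ht ↦ (hq t ⟨ht.1, ht.2.le⟩).hasDerivWithinAt) 1 (by simp)
  have e0 : ∀ {γ δ : C(I, E)} {x : E}, γ = constCurve E x + volterra E δ → γ 0 = x := by
    intro γ δ x h
    rw [h, ContinuousMap.add_apply, volterra_apply]
    simp
  have h1 : q 1 = η (γ 1) (A 1) (B 1) := by
    have e1 := hg 1
    have e2 := hgA 1
    have e3 := hgB 1
    rw [Icc.coe_one] at e1 e2 e3
    simp [q, interpolatedForm, e1, e2, e3]
  have h0 : q 0 = η 0 a b := by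
    have e2 := hgA 0
    have e3 := hgB 0
    rw [Icc.coe_zero] at e2 e3
    simp [q, interpolatedForm, e2, e3, e0 hA, e0 hB]
  rw [← h1, hconst, h0]

/-- **Darboux's theorem** in a normed space: a closed form that is nondegenerate at `0` is
constant in suitable local coordinates near `0`. -/
theorem exists_darboux_coordinates [CompleteSpace E] (hr : 0 < r)
    (hη : ContDiffOn ℝ ∞ η (Metric.ball 0 r))
    (halt : ∀ x ∈ Metric.ball (0 : E) r, ∀ a b, η x a b = -η x b a)
    (hcl : ∀ x ∈ Metric.ball (0 : E) r, ∀ a b c,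
      fderiv ℝ η x a b c - fderiv ℝ η x b a c + fderiv ℝ η x c a b = 0)
    (e : E ≃L[ℝ] (E →L[ℝ] ℝ)) (he : (e : E →L[ℝ] (E →L[ℝ] ℝ)) = η 0) :
    ∃ h : OpenPartialHomeomorph E E, (0 : E) ∈ h.source ∧ h 0 = 0 ∧
      h.target ⊆ Metric.ball 0 r ∧ ContDiffOn ℝ ∞ h h.source ∧ ContDiffOn ℝ ∞ h.symm h.target ∧
      ∀ x ∈ h.source, ∀ a b, η (h x) (fderiv ℝ h x a) (fderiv ℝ h x b) = η 0 a b := by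
  have hD := isOpen_moserDomain hη
  have hX := contDiffOn_moserField hη
  have h0D : ∀ t : ℝ, (t, (0 : E)) ∈ moserDomain η r := fun t ↦
    ⟨Metric.mem_ball_self hr, e, by simp [he, interpolatedForm]⟩
  obtain ⟨V, Γ, hV, h0V, hΓ, hΓ0, hΓV⟩ := exists_smooth_flow hD hX (fun t _ ↦ h0D t)
    (fun t _ ↦ by simp [moserField, radialPrimitive_zero])
    (fun t _ v ↦ fderiv_moserField_zero hη hr (h0D t) v)
  have hΓ' := fun {x} (hx : x ∈ V) ↦ fderiv_flow_eq hD hX hV hΓ (fun x hx ↦ (hΓV x hx).1)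
    (fun x hx ↦ (hΓV x hx).2) hx
  set ev : C(I, E) →L[ℝ] E := ContinuousMap.evalCLM ℝ (1 : I)
  set ψ : E → E := fun x ↦ ev (Γ x)
  have hψ : ContDiffOn ℝ ∞ ψ V := ev.contDiff.comp_contDiffOn hΓ
  have hψ' : ∀ x ∈ V, HasFDerivAt ψ (ev.comp (fderiv ℝ Γ x)) x := fun x hx ↦
    ev.hasFDerivAt.comp x
      ((hΓ.contDiffAt (hV.mem_nhds hx)).differentiableAt (by simp)).hasFDerivAt
  -- Along the zero curve the linearized field vanishes, so the time-one map has derivative the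
  -- identity at `0` and is invertible nearby.
  have hid : ev.comp (fderiv ℝ Γ 0) =
      ((ContinuousLinearEquiv.refl ℝ E : E ≃L[ℝ] E) : E →L[ℝ] E) := by
    ext a
    have h1 := hΓ' h0V a
    have h2 : fderiv ℝ (timePostcomp (moserField η)) (Γ 0) (fderiv ℝ Γ 0 a) = 0 := by
      ext t
      rw [fderiv_timePostcomp_apply hD hX (hΓV 0 h0V).1, hΓ0]
      exact fderiv_moserField_zero hη hr (h0D t) _
    rw [h2, map_zero, add_zero] at h1
    simp only [ContinuousLinearMap.comp_apply, h1]
    rfl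
  obtain ⟨h, h0h, hhV, hhψ, hhs⟩ := exists_openPartialHomeomorph_of_contDiffOn hV hψ h0V _
    (hid ▸ hψ' 0 h0V)
  have hfun : (h : E → E) = ψ := funext hhψ
  refine ⟨h, h0h, ?_, ?_, ?_, hhs, ?_⟩
  · rw [hhψ]
    simp [ψ, ev, hΓ0]
  · intro y hy
    have := (hΓV _ (hhV (h.map_target hy))).1 1
    have h3 := h.right_inv hy
    rw [hhψ] at h3
    rw [← h3]
    exact this.1
  · rw [hfun]; exact hψ.mono hhV
  · intro x hx a b
    have hxV := hhV hx
    rw [hfun, (hψ' x hxV).fderiv]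
    exact pullback_moser_flow hη halt hcl (hΓV x hxV).1 (hΓV x hxV).2 (hΓ' hxV a) (hΓ' hxV b)

end NormalForm

/-! ### Darboux charts on a symplectic manifold. -/

section DarbouxChart

universe u

variable {E : Type u} [NormedAddCommGroup E] [NormedSpace ℝ E]

theorem twoForm_swap (w : E [⋀^Fin 2]→L[ℝ] ℝ) (a b : E) : w ![a, b] = -w ![b, a] := by
  have h := w.toAlternatingMap.map_swap ![b, a] (i := 0) (j := 1) (by simp)
  have h' : ![b, a] ∘ Equiv.swap (0 : Fin 2) 1 = ![a, b] := by
    ext i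
    fin_cases i <;> simp
  rw [h'] at h
  exact h

theorem norm_twoForm_le (w : E [⋀^Fin 2]→L[ℝ] ℝ) (a b : E) : ‖w ![a, b]‖ ≤ ‖w‖ * ‖a‖ * ‖b‖ := by
  simpa [Fin.prod_univ_two, mul_assoc] using w.le_opNorm ![a, b]

/-- A 2-form as a bilinear map. -/
noncomputable def twoFormCurry : E [⋀^Fin 2]→L[ℝ] ℝ →L[ℝ] E →L[ℝ] E →L[ℝ] ℝ :=
  LinearMap.mkContinuous
    { toFun := fun w ↦ LinearMap.mkContinuous₂
        (LinearMap.mk₂ ℝ (fun a b ↦ w ![a, b])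
          (fun a a' b ↦ w.vecCons_add ![b] a a')
          (fun c a b ↦ w.vecCons_smul ![b] c a)
          (fun a b b' ↦ by
            have := w.vecCons_add ![a] b b'
            rw [twoForm_swap, twoForm_swap w a, twoForm_swap w a, this, neg_add])
          (fun c a b ↦ by
            have := w.vecCons_smul ![a] c b
            rw [twoForm_swap, twoForm_swap w a, this, smul_neg])) ‖w‖
        (norm_twoForm_le w)
      map_add' := fun _ _ ↦ rfl
      map_smul' := fun _ _ ↦ rfl } 1
    (fun w ↦ by
      rw [one_mul]
      exact ContinuousLinearMap.opNorm_le_bound₂ _ (norm_nonneg w) (norm_twoForm_le w))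

@[simp]
theorem twoFormCurry_apply (w : E [⋀^Fin 2]→L[ℝ] ℝ) (a b : E) :
    twoFormCurry w a b = w ![a, b] := rfl

theorem extDeriv_twoForm_apply (w : E → E [⋀^Fin 2]→L[ℝ] ℝ) (x a b c : E) :
    extDeriv w x ![a, b, c] =
      fderiv ℝ w x a ![b, c] - fderiv ℝ w x b ![a, c] + fderiv ℝ w x c ![a, b] := by
  rw [extDeriv, ContinuousAlternatingMap.alternatizeUncurryFin_apply, Fin.sum_univ_three]
  have h0 : (0 : Fin 3).removeNth ![a, b, c] = ![b, c] := by
    ext i; fin_cases i <;> rfl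
  have h1 : (1 : Fin 3).removeNth ![a, b, c] = ![a, c] := by
    ext i; fin_cases i <;> rfl
  have h2 : (2 : Fin 3).removeNth ![a, b, c] = ![a, b] := by
    ext i; fin_cases i <;> rfl
  rw [h0, h1, h2]
  simp
  ring

/-- A nondegenerate bilinear form on a finite-dimensional space identifies it with its dual. -/
theorem exists_equiv_of_nondegenerate [FiniteDimensional ℝ E] (B : E →L[ℝ] E →L[ℝ] ℝ)
    (hB : ∀ a, (∀ b, B a b = 0) → a = 0) :
    ∃ e : E ≃L[ℝ] (E →L[ℝ] ℝ), (e : E →L[ℝ] (E →L[ℝ] ℝ)) = B := by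
  have hinj : Function.Injective B.toLinearMap := by
    rw [← LinearMap.ker_eq_bot, LinearMap.ker_eq_bot']
    intro a ha
    refine hB a fun b ↦ ?_
    have : B a = 0 := ha
    rw [this]; rfl
  have hdim : Module.finrank ℝ E = Module.finrank ℝ (E →L[ℝ] ℝ) := by
    rw [← (LinearMap.toContinuousLinearMap : (E →ₗ[ℝ] ℝ) ≃ₗ[ℝ] (E →L[ℝ] ℝ)).finrank_eq]
    exact (Subspace.dual_finrank_eq (K := ℝ) (V := E)).symm
  have : FiniteDimensional ℝ (E →L[ℝ] ℝ) :=
    (LinearMap.toContinuousLinearMap : (E →ₗ[ℝ] ℝ) ≃ₗ[ℝ] (E →L[ℝ] ℝ)).finiteDimensional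
  refine ⟨(LinearEquiv.ofInjectiveOfFinrankEq B.toLinearMap hinj hdim).toContinuousLinearEquiv, ?_⟩
  ext a b
  rfl

variable {M : Type*} [TopologicalSpace M] [ChartedSpace E M]

/-- The derivative of a map between the model space and the manifold, or between open sets of them,
as an operator on the model space. -/
noncomputable abbrev chartDeriv (c : M → E) (m : M) : E →L[ℝ] E := mfderiv 𝓘(ℝ, E) 𝓘(ℝ, E) c m

/-- The derivative of a parametrization `E → M`, as an operator on the model space. -/
noncomputable abbrev paramDeriv (k : E → M) (x : E) : E →L[ℝ] E := mfderiv 𝓘(ℝ, E) 𝓘(ℝ, E) k x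

/-- A smooth chart in which the form `Ω` has the constant expression `B`. -/
structure IsDarbouxChart [IsManifold 𝓘(ℝ, E) ∞ M] (Ω : M → E [⋀^Fin 2]→L[ℝ] ℝ)
    (B : E →L[ℝ] E →L[ℝ] ℝ) (c : OpenPartialHomeomorph M E) : Prop where
  contMDiffOn : ContMDiffOn 𝓘(ℝ, E) 𝓘(ℝ, E) ∞ c c.source
  contMDiffOn_symm : ContMDiffOn 𝓘(ℝ, E) 𝓘(ℝ, E) ∞ c.symm c.target
  symm_pullback : ∀ y ∈ c.target, ∀ a b : E,
    Ω (c.symm y) ![paramDeriv c.symm y a, paramDeriv c.symm y b] = B a b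

/-- The chart at `m`, translated so that `m` sits at `0`, is corrected by Darboux coordinates for
the local form. The constant form `B` is not normalized and may depend on the chart: only its
constancy is needed for gluing. -/
theorem exists_isDarbouxChart [FiniteDimensional ℝ E] [IsManifold 𝓘(ℝ, E) ∞ M]
    (Ω : M → E [⋀^Fin 2]→L[ℝ] ℝ) (hΩ : IsSymplecticForm (E := E) (M := M) Ω) (m : M) :
    ∃ (B : E →L[ℝ] E →L[ℝ] ℝ) (c : OpenPartialHomeomorph M E), m ∈ c.source ∧
      IsDarbouxChart Ω B c := by
  have : CompleteSpace E := FiniteDimensional.complete ℝ E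
  set k := (chartAt E m).symm
  have hk : ContMDiffOn 𝓘(ℝ, E) 𝓘(ℝ, E) ∞ k k.source := contMDiffOn_chart_symm
  have hk' : ContMDiffOn 𝓘(ℝ, E) 𝓘(ℝ, E) ∞ k.symm k.target := contMDiffOn_chart
  have hkd : k.MDifferentiable 𝓘(ℝ, E) 𝓘(ℝ, E) :=
    ⟨hk.mdifferentiableOn (by simp), hk'.mdifferentiableOn (by simp)⟩
  have hext : ((extChartAt 𝓘(ℝ, E) m).symm : E → M) = k := by
    simp [k, extChartAt, OpenPartialHomeomorph.extend]
  have htgt : (extChartAt 𝓘(ℝ, E) m).target = k.source := by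
    simp [k, extChartAt, OpenPartialHomeomorph.extend]
  set x₀ : E := chartAt E m m
  have hx₀ : x₀ ∈ k.source := (chartAt E m).map_source (mem_chart_source E m)
  obtain ⟨r, hr, hball⟩ := Metric.isOpen_iff.1 k.open_source x₀ hx₀
  have hmaps : ∀ x ∈ Metric.ball (0 : E) r, x₀ + x ∈ k.source := fun x hx ↦ hball (by
    rw [mem_ball_iff_norm]; simpa using hx)
  set w : E → E [⋀^Fin 2]→L[ℝ] ℝ := localForm Ω m
  set η : E → E →L[ℝ] E →L[ℝ] ℝ := fun x ↦ twoFormCurry (w (x₀ + x))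
  have hwη : ∀ y ∈ k.source, ∀ a b : E,
      w y ![a, b] = Ω (k y) ![paramDeriv k y a, paramDeriv k y b] := by
    intro y _ a b
    have h1 : ∀ (k' : E → M), k' = k →
        (Ω (k' y)) (fun i ↦ paramDeriv k' y (![a, b] i)) =
          Ω (k y) ![paramDeriv k y a, paramDeriv k y b] := by
      rintro _ rfl
      congr 1
      ext i
      fin_cases i <;> rfl
    exact h1 _ hext
  have hw : ContDiffOn ℝ ∞ w k.source := htgt ▸ hΩ.smooth m
  have hη : ContDiffOn ℝ ∞ η (Metric.ball 0 r) :=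
    (twoFormCurry (E := E)).contDiff.comp_contDiffOn (hw.comp (contDiff_const.add contDiff_id).contDiffOn hmaps)
  have halt : ∀ x ∈ Metric.ball (0 : E) r, ∀ a b, η x a b = -η x b a :=
    fun x _ a b ↦ twoForm_swap (w (x₀ + x)) a b
  have hcl : ∀ x ∈ Metric.ball (0 : E) r, ∀ a b c,
      fderiv ℝ η x a b c - fderiv ℝ η x b a c + fderiv ℝ η x c a b = 0 := by
    intro x hx a b c
    have hwx := ((hw.contDiffAt (k.open_source.mem_nhds (hmaps x hx))).differentiableAt
      (by simp)).hasFDerivAt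
    have h1 : HasFDerivAt η (twoFormCurry.comp (fderiv ℝ w (x₀ + x))) x :=
      twoFormCurry.hasFDerivAt.comp x
        ((hwx.comp x ((hasFDerivAt_id x).const_add x₀)).congr_fderiv
          (by ext; simp))
    rw [h1.fderiv]
    have h2 := hΩ.closed m (x₀ + x) (htgt ▸ hmaps x hx)
    have h3 := extDeriv_twoForm_apply w (x₀ + x) a b c
    rw [h2] at h3
    exact h3.symm
  have hnd : ∀ a, (∀ b, η 0 a b = 0) → a = 0 := by
    intro a ha
    have h1 : ∀ v : E, Ω (k x₀) ![paramDeriv k x₀ a, v] = 0 := by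
      intro v
      obtain ⟨b, rfl⟩ := hkd.mfderiv_surjective hx₀ v
      have h2 := ha b
      simp only [η, add_zero] at h2
      exact (hwη x₀ hx₀ a b).symm.trans h2
    have h2 := hΩ.nondegenerate (k x₀) _ h1
    exact hkd.mfderiv_injective hx₀ (h2.trans (map_zero _).symm)
  obtain ⟨e, he⟩ := exists_equiv_of_nondegenerate (η 0) hnd
  obtain ⟨h, h0s, h00, htb, hh, hhs, hpull⟩ := exists_darboux_coordinates hr hη halt hcl e he
  set T : OpenPartialHomeomorph E E := (Homeomorph.addLeft x₀).toOpenPartialHomeomorph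
  set c' := (h.trans T).trans k
  have hTc : ∀ x, T x = x₀ + x := fun x ↦ rfl
  have hc'k : (c' : E → M) = fun x ↦ k (x₀ + h x) := rfl
  have hc's : ((c'.symm : M → E)) = fun p ↦ h.symm (-x₀ + k.symm p) := rfl
  have hsrc : ∀ y ∈ c'.source, y ∈ h.source := fun y hy ↦ hy.1.1
  have hsrc' : ∀ y ∈ h.source, x₀ + h y ∈ k.source := fun y hy ↦
    hmaps _ (htb (h.map_source hy))
  have hinner : ContDiffOn ℝ ∞ (fun x ↦ x₀ + h x) h.source := contDiffOn_const.add hh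
  refine ⟨η 0, c'.symm, ?_, ?_, ?_, ?_⟩
  · change m ∈ c'.target
    have h0c : (0 : E) ∈ c'.source := ⟨⟨h0s, trivial⟩, hsrc' 0 h0s⟩
    have := c'.map_source h0c
    rw [hc'k] at this
    simp only [h00, add_zero] at this
    rwa [show k x₀ = m from (chartAt E m).left_inv (mem_chart_source E m)] at this
  · rw [hc's]
    change ContMDiffOn _ _ _ _ c'.target
    have h1 : ContMDiffOn 𝓘(ℝ, E) 𝓘(ℝ, E) ∞ (fun p ↦ -x₀ + k.symm p) c'.target :=
      ((contDiff_const.add contDiff_id).contMDiff (n := ∞)).comp_contMDiffOn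
        (hk'.mono fun p hp ↦ hp.1)
    exact hhs.contMDiffOn.comp h1 fun p hp ↦ hp.2.2
  · change ContMDiffOn _ _ _ c' c'.source
    rw [hc'k]
    exact hk.comp (hinner.contMDiffOn.mono hsrc) fun y hy ↦ hsrc' y (hsrc y hy)
  · intro y hy a b
    change y ∈ c'.source at hy
    have hyh := hsrc y hy
    have hd : paramDeriv c' y = (paramDeriv k (x₀ + h y)).comp (fderiv ℝ h y) := by
      have hin : HasFDerivAt (fun x ↦ x₀ + h x) (fderiv ℝ h y) y :=
        (((hh.contDiffAt (h.open_source.mem_nhds hyh)).differentiableAt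
          (by simp)).hasFDerivAt).const_add x₀
      have := (hkd.mdifferentiableAt (hsrc' y hyh)).hasMFDerivAt.comp y hin.hasMFDerivAt
      exact this.mfderiv
    have := hpull y hyh a b
    rw [← this]
    change Ω (c' y) ![paramDeriv c' y a, paramDeriv c' y b] = w (x₀ + h y) ![_, _]
    rw [hwη _ (hsrc' y hyh), hd]
    rfl

end DarbouxChart

/-! ### Alexander's trick for families of symplectic maps. -/

section Alexander

universe u

variable {E : Type u} [NormedAddCommGroup E] [NormedSpace ℝ E]

/-- A smooth family `f (x, ·)` of maps defined near `0`, with `f (x, 0) = x` and derivative the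
identity at `0`, which preserve the constant form `B`. -/
structure IsSymplecticFamilyOn (B : E →L[ℝ] E →L[ℝ] ℝ) (f : E × E → E) (O : Set (E × E)) :
    Prop where
  contDiffOn : ContDiffOn ℝ ∞ f O
  preserves : ∀ p ∈ O, ∀ a b : E, B (fderiv ℝ f p (0, a)) (fderiv ℝ f p (0, b)) = B a b
  zero : ∀ x : E, (x, (0 : E)) ∈ O → f (x, 0) = x
  fderiv_zero : ∀ x : E, (x, (0 : E)) ∈ O → ∀ a : E, fderiv ℝ f (x, 0) (0, a) = a

open Classical in
/-- Alexander's trick: the rescaled family `(x, w) ↦ x + (f (x, s w) - x) / s`, where `s` is a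
function of `x`; for `s = 0` it is `x + w`. -/
noncomputable def alexander (f : E × E → E) (s : E → ℝ) (p : E × E) : E :=
  if s p.1 = 0 then p.1 + p.2 else p.1 + (s p.1)⁻¹ • (f (p.1, s p.1 • p.2) - p.1)

/-- The integral formula for the rescaled family, which shows its smoothness. -/
theorem alexander_eq_integral [CompleteSpace E] {f : E × E → E} {O : Set (E × E)} (hO : IsOpen O)
    (hf : ContDiffOn ℝ ∞ f O) (hf0 : ∀ x : E, (x, (0 : E)) ∈ O → f (x, 0) = x)
    (hf1 : ∀ x : E, (x, (0 : E)) ∈ O → ∀ a : E, fderiv ℝ f (x, 0) (0, a) = a)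
    {s : E → ℝ} {p : E × E} (hp : ∀ t ∈ Icc (0 : ℝ) 1, (p.1, t • s p.1 • p.2) ∈ O) :
    alexander f s p =
      p.1 + ∫ t in (0 : ℝ)..1, fderiv ℝ f (p.1, t • s p.1 • p.2) (0, p.2) := by
  obtain ⟨x, w⟩ := p
  have h0 : (x, (0 : E)) ∈ O := by simpa using hp 0 (by simp)
  by_cases hs : s x = 0
  · simp [alexander, hs, hf1 x h0]
  · simp only [alexander, if_neg hs]
    congr 1
    have hcurve : ∀ t : ℝ, HasDerivAt (fun t : ℝ ↦ (x, t • s x • w)) ((0 : E), s x • w) t :=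
      fun t ↦ (hasDerivAt_const t x).prodMk (by simpa using (hasDerivAt_id t).smul_const (s x • w))
    have hderiv : ∀ t ∈ uIcc (0 : ℝ) 1, HasDerivAt (fun t : ℝ ↦ (s x)⁻¹ • f (x, t • s x • w))
        (fderiv ℝ f (x, t • s x • w) (0, w)) t := by
      intro t ht
      rw [uIcc_of_le zero_le_one] at ht
      have hfp := ((hf.contDiffAt (hO.mem_nhds (hp t ht))).differentiableAt (by simp)).hasFDerivAt
      have := (hfp.comp_hasDerivAt t (hcurve t)).const_smul (s x)⁻¹
      refine this.congr_deriv ?_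
      rw [show ((0 : E), s x • w) = s x • ((0 : E), w) by simp, map_smul, inv_smul_smul₀ hs]
    have hcont : ContinuousOn (fun t : ℝ ↦ fderiv ℝ f (x, t • s x • w) (0, w)) (uIcc 0 1) := by
      rw [uIcc_of_le zero_le_one]
      have h1 := hf.continuousOn_fderiv_of_isOpen hO (by simp)
      have h2 : ContinuousOn (fun t : ℝ ↦ (x, t • s x • w)) (Icc 0 1) := by fun_prop
      exact (h1.comp h2 fun t ht ↦ hp t ht).clm_apply continuousOn_const
    rw [intervalIntegral.integral_eq_sub_of_hasDerivAt hderiv hcont.intervalIntegrable]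
    simp [hf0 x h0, smul_sub]

/-- The factors `s` and `1 / s` cancel in the fibre derivative, leaving that of `f` at `(x, s w)`;
this also holds at `s = 0`, where both are the identity. Smoothness across the zeros of `s` comes
from the integral formula, which contains no division. -/
theorem IsSymplecticFamilyOn.alexander [CompleteSpace E] {B : E →L[ℝ] E →L[ℝ] ℝ} {f : E × E → E}
    {O : Set (E × E)} (hf : IsSymplecticFamilyOn B f O) (hO : IsOpen O) {x₀ : E}
    (h0 : (x₀, (0 : E)) ∈ O) {s : E → ℝ} {N : Set E} (hN : IsOpen N) (hx₀ : x₀ ∈ N)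
    (hs : ContDiffOn ℝ ∞ s N) (hs01 : ∀ x, s x ∈ Icc (0 : ℝ) 1) :
    ∃ O' : Set (E × E), IsOpen O' ∧ (x₀, (0 : E)) ∈ O' ∧
      IsSymplecticFamilyOn B (alexander f s) O' := by
  obtain ⟨r, hr, hball⟩ := Metric.isOpen_iff.1 hO _ h0
  set V : Set E := N ∩ Metric.ball x₀ r
  have hV : IsOpen V := hN.inter Metric.isOpen_ball
  -- A product with a ball about `0` is stable under scaling the fibre variable by numbers in `[0,
  -- 1]`.
  set O' : Set (E × E) := V ×ˢ Metric.ball (0 : E) r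
  have hO' : IsOpen O' := hV.prod Metric.isOpen_ball
  have hO'O : O' ⊆ O := fun p hp ↦ hball (by
    rw [← ball_prod_same]; exact ⟨hp.1.2, hp.2⟩)
  have hscale : ∀ p ∈ O', (p.1, s p.1 • p.2) ∈ O' := fun p hp ↦
    ⟨hp.1, smul_mem_ball_of_mem_Icc hp.2 (hs01 p.1)⟩
  have hscale' : ∀ p ∈ O', ∀ t ∈ Icc (0 : ℝ) 1, (p.1, t • s p.1 • p.2) ∈ O' := fun p hp t ht ↦
    ⟨hp.1, smul_mem_ball_of_mem_Icc (hscale p hp).2 ht⟩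
  have hzero : ∀ p ∈ O', (p.1, (0 : E)) ∈ O' := fun p hp ↦
    ⟨hp.1, Metric.mem_ball_self hr⟩
  have hsmooth : ContDiffOn ℝ ∞ (SymplecticThickening.alexander f s) O' := by
    have hsnd : ContDiff ℝ ∞ (fun q : ℝ × (E × E) ↦ q.2.2) := contDiff_snd.comp contDiff_snd
    have hs' : ContDiffOn ℝ ∞ (fun q : ℝ × (E × E) ↦ s q.2.1) {q | q.2.1 ∈ N} :=
      hs.comp (contDiff_fst.comp contDiff_snd).contDiffOn fun _ h ↦ h
    set κ : ℝ × (E × E) → E × E := fun q ↦ (q.2.1, q.1 • s q.2.1 • q.2.2)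
    have hκ : ContDiffOn ℝ ∞ κ {q | q.2.1 ∈ N} :=
      (contDiff_fst.comp contDiff_snd).contDiffOn.prodMk
        (contDiff_fst.contDiffOn.smul (hs'.smul (contDiff_snd.comp contDiff_snd).contDiffOn))
    set U : Set (ℝ × (E × E)) := {q | q.2.1 ∈ N} ∩ κ ⁻¹' O'
    have hNo : IsOpen {q : ℝ × (E × E) | q.2.1 ∈ N} :=
      hN.preimage (continuous_fst.comp continuous_snd)
    have hU : IsOpen U := hκ.continuousOn.isOpen_inter_preimage hNo hO'
    have hD : ContDiffOn ℝ ∞ (fderiv ℝ f) O := hf.contDiffOn.fderiv_of_isOpen hO (by simp)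
    have hF : ContDiffOn ℝ ∞ (fun q : ℝ × (E × E) ↦ fderiv ℝ f (κ q) ((0 : E), q.2.2)) U :=
      (hD.comp (hκ.mono inter_subset_left) fun q hq ↦ hO'O hq.2).clm_apply
        (contDiffOn_const.prodMk hsnd.contDiffOn)
    have hint := contDiffOn_integral_param (E := E × E) hU hF (V := O')
      (fun p hp t ht ↦ ⟨hp.1.1, hscale' p hp t ht⟩)
    exact (contDiff_fst.contDiffOn.add hint).congr fun p hp ↦
      alexander_eq_integral hO hf.contDiffOn hf.zero hf.fderiv_zero
        fun t ht ↦ hO'O (hscale' p hp t ht)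
  have hpart : ∀ p ∈ O', ∀ a : E, fderiv ℝ (SymplecticThickening.alexander f s) p (0, a) =
      fderiv ℝ f (p.1, s p.1 • p.2) (0, a) := by
    rintro ⟨x, w⟩ hp a
    have h1 := ((hsmooth.contDiffAt (hO'.mem_nhds hp)).differentiableAt (by simp)).hasFDerivAt
    have h2 := h1.comp w (hasFDerivAt_prodMk_right x w)
    by_cases hsx : s x = 0
    · have h3 : HasFDerivAt (fun w' : E ↦ SymplecticThickening.alexander f s (x, w'))
          (ContinuousLinearMap.id ℝ E) w := by
        simp only [SymplecticThickening.alexander, hsx, if_true]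
        exact (hasFDerivAt_id w).const_add x
      have h4 := congrArg (fun L : E →L[ℝ] E ↦ L a) (h2.unique h3)
      simp only [hsx, zero_smul]
      rw [hf.fderiv_zero x (hO'O (hzero _ hp))]
      exact h4
    · have hq := hO'O (hscale _ hp)
      have h5 := ((hf.contDiffOn.contDiffAt (hO.mem_nhds hq)).differentiableAt
        (by simp)).hasFDerivAt
      have h6 := (((h5.comp w ((hasFDerivAt_prodMk_right x (s x • w)).comp w
        ((hasFDerivAt_id w).const_smul (s x)))).sub_const x).const_smul (s x)⁻¹).const_add x
      have h3 : (fun w' : E ↦ SymplecticThickening.alexander f s (x, w')) =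
          fun w' ↦ x + (s x)⁻¹ • (f (x, s x • w') - x) := by
        ext w'
        simp [SymplecticThickening.alexander, hsx]
      have h4 := congrArg (fun L : E →L[ℝ] E ↦ L a)
        (h2.unique (h6.congr_of_eventuallyEq (Eventually.of_forall (congrFun h3))))
      refine h4.trans ?_
      change (s x)⁻¹ • fderiv ℝ f (x, s x • w) (0, s x • a) = _
      rw [show ((0 : E), s x • a) = s x • ((0 : E), a) by simp, map_smul, inv_smul_smul₀ hsx]
  refine ⟨O', hO', ⟨⟨hx₀, Metric.mem_ball_self hr⟩, Metric.mem_ball_self hr⟩, hsmooth, ?_, ?_, ?_⟩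
  · intro p hp a b
    rw [hpart p hp, hpart p hp]
    exact hf.preserves _ (hO'O (hscale p hp)) a b
  · intro x hx
    simp [SymplecticThickening.alexander, hf.zero x (hO'O hx)]
  · intro x hx a
    rw [hpart _ hx]
    simpa using hf.fderiv_zero x (hO'O hx) a

end Alexander

/-! ### Passage between symplectic families in a chart and maps on the tangent bundle. -/

section Families

universe u

variable {E : Type u} [NormedAddCommGroup E] [NormedSpace ℝ E]
variable {M : Type*} [TopologicalSpace M] [ChartedSpace E M] [IsManifold 𝓘(ℝ, E) ∞ M]

/-- The coordinates on the tangent bundle induced by a chart `c`. -/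
noncomputable def tanCoord (c : OpenPartialHomeomorph M E) (p : TangentBundle 𝓘(ℝ, E) M) : E × E :=
  (c p.1, chartDeriv c p.1 p.2)

/-- The parametrization of the tangent bundle induced by a chart `c`. -/
noncomputable def tanParam (c : OpenPartialHomeomorph M E) (q : E × E) : TangentBundle 𝓘(ℝ, E) M :=
  ⟨c.symm q.1, paramDeriv c.symm q.1 q.2⟩

variable {Ω : M → E [⋀^Fin 2]→L[ℝ] ℝ} {B : E →L[ℝ] E →L[ℝ] ℝ} {c : OpenPartialHomeomorph M E}

namespace IsDarbouxChart

theorem mdifferentiable (hc : IsDarbouxChart Ω B c) : c.MDifferentiable 𝓘(ℝ, E) 𝓘(ℝ, E) :=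
  ⟨hc.contMDiffOn.mdifferentiableOn (by simp), hc.contMDiffOn_symm.mdifferentiableOn (by simp)⟩

theorem paramDeriv_chartDeriv (hc : IsDarbouxChart Ω B c) {m : M} (hm : m ∈ c.source) (a : E) :
    paramDeriv c.symm (c m) (chartDeriv c m a) = a :=
  congrArg (fun L : E →L[ℝ] E ↦ L a) (hc.mdifferentiable.symm_comp_deriv hm)

theorem chartDeriv_paramDeriv (hc : IsDarbouxChart Ω B c) {y : E} (hy : y ∈ c.target) (a : E) :
    chartDeriv c (c.symm y) (paramDeriv c.symm y a) = a :=
  congrArg (fun L : E →L[ℝ] E ↦ L a) (hc.mdifferentiable.comp_symm_deriv hy)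

theorem pullback (hc : IsDarbouxChart Ω B c) {m : M} (hm : m ∈ c.source) (a b : E) :
    B (chartDeriv c m a) (chartDeriv c m b) = Ω m ![a, b] := by
  rw [← hc.symm_pullback (c m) (c.map_source hm), hc.paramDeriv_chartDeriv hm,
    hc.paramDeriv_chartDeriv hm, c.left_inv hm]

theorem tanParam_tanCoord (hc : IsDarbouxChart Ω B c) {p : TangentBundle 𝓘(ℝ, E) M}
    (hp : p.1 ∈ c.source) : tanParam c (tanCoord c p) = p := by
  obtain ⟨m, v⟩ := p
  -- Every tangent space is `E` by definition, so base points and vectors can be compared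
  -- separately, without transport.
  have h1 : ∀ m' : M, m' = m → ∀ w : E, w = v →
      (⟨m', w⟩ : TangentBundle 𝓘(ℝ, E) M) = ⟨m, v⟩ := by
    rintro _ rfl _ rfl; rfl
  exact h1 _ (c.left_inv hp) _ (hc.paramDeriv_chartDeriv hp v)

theorem contMDiffOn_tanCoord (hc : IsDarbouxChart Ω B c) :
    ContMDiffOn 𝓘(ℝ, E).tangent 𝓘(ℝ, E × E) ∞ (tanCoord c)
      (Bundle.TotalSpace.proj ⁻¹' c.source) := by
  have h1 := hc.contMDiffOn.contMDiffOn_tangentMapWithin (m := ∞) (by simp)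
    c.open_source.uniqueMDiffOn
  have h2 := (contMDiff_snd_tangentBundle_modelSpace (n := ∞) E 𝓘(ℝ, E)).comp_contMDiffOn h1
  have h3 : ContMDiffOn 𝓘(ℝ, E).tangent 𝓘(ℝ, E) ∞
      (fun p : TangentBundle 𝓘(ℝ, E) M ↦ chartDeriv c p.1 p.2)
      (Bundle.TotalSpace.proj ⁻¹' c.source) := by
    refine h2.congr fun p hp ↦ ?_
    change _ = mfderivWithin 𝓘(ℝ, E) 𝓘(ℝ, E) c c.source p.1 p.2
    rw [mfderivWithin_of_isOpen c.open_source hp]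
    rfl
  exact (hc.contMDiffOn.comp (Bundle.contMDiff_proj (TangentSpace 𝓘(ℝ, E))).contMDiffOn
    fun _ h ↦ h).prodMk_space h3

theorem contMDiffOn_tanParam (hc : IsDarbouxChart Ω B c) :
    ContMDiffOn 𝓘(ℝ, E × E) 𝓘(ℝ, E).tangent ∞ (tanParam c) (c.target ×ˢ univ) := by
  have h1 := hc.contMDiffOn_symm.contMDiffOn_tangentMapWithin (m := ∞) (by simp)
    c.open_target.uniqueMDiffOn
  have h2 : ContMDiff 𝓘(ℝ, E × E) 𝓘(ℝ, E).tangent ∞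
      (fun q : E × E ↦ (⟨q.1, q.2⟩ : TangentBundle 𝓘(ℝ, E) E)) := by
    have := contMDiff_tangentBundleModelSpaceHomeomorph_symm (n := ∞) (I := 𝓘(ℝ, E))
    rw [modelWithCornersSelf_prod]
    exact this
  refine (h1.comp h2.contMDiffOn (s := c.target ×ˢ univ) fun q hq ↦ hq.1).congr fun q hq ↦ ?_
  change tanParam c q = ⟨c.symm q.1, mfderivWithin 𝓘(ℝ, E) 𝓘(ℝ, E) c.symm c.target q.1 q.2⟩
  rw [mfderivWithin_of_isOpen c.open_target hq.1]
  rfl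

end IsDarbouxChart

/-- The derivative along the fibre of a map defined on the tangent bundle. -/
noncomputable abbrev fibreDeriv (φ : TangentBundle 𝓘(ℝ, E) M → M) (m : M) (v : E) : E →L[ℝ] E :=
  mfderiv 𝓘(ℝ, E) 𝓘(ℝ, E) (fun w : E ↦ φ ⟨m, w⟩) v

/-- A smooth map on an open set of the tangent bundle whose restrictions to the fibres are symplectic
for the constant forms, and tangent to the identity along the zero section. -/
structure IsSymplecticThickeningOn (Ω : M → E [⋀^Fin 2]→L[ℝ] ℝ)
    (φ : TangentBundle 𝓘(ℝ, E) M → M) (O : Set (TangentBundle 𝓘(ℝ, E) M)) : Prop where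
  isOpen : IsOpen O
  contMDiffOn : ContMDiffOn 𝓘(ℝ, E).tangent 𝓘(ℝ, E) ∞ φ O
  preserves : ∀ (m : M) (v : E), ⟨m, v⟩ ∈ O → ∀ a b : E,
    Ω (φ ⟨m, v⟩) ![fibreDeriv φ m v a, fibreDeriv φ m v b] = Ω m ![a, b]
  zero : ∀ m : M, ⟨m, 0⟩ ∈ O → φ ⟨m, 0⟩ = m
  fibreDeriv_zero : ∀ m : M, ⟨m, 0⟩ ∈ O → ∀ a : E, fibreDeriv φ m 0 a = a

theorem continuous_fibreInclusion (m : M) :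
    Continuous (fun v : E ↦ (⟨m, v⟩ : TangentBundle 𝓘(ℝ, E) M)) :=
  FiberBundle.continuous_totalSpaceMk E (TangentSpace 𝓘(ℝ, E) : M → Type _) m

theorem contMDiff_fibreInclusion (m : M) :
    ContMDiff 𝓘(ℝ, E) 𝓘(ℝ, E).tangent ∞ (fun v : E ↦ (⟨m, v⟩ : TangentBundle 𝓘(ℝ, E) M)) := by
  intro v
  rw [Bundle.contMDiffAt_totalSpace]
  refine ⟨contMDiffAt_const, ?_⟩
  set e := trivializationAt E (TangentSpace 𝓘(ℝ, E) : M → Type _) m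
  have hm : m ∈ e.baseSet := mem_baseSet_trivializationAt E (TangentSpace 𝓘(ℝ, E)) m
  let L : E →L[ℝ] E := e.continuousLinearMapAt ℝ m
  have h : (fun w : E ↦ (e (⟨m, w⟩ : TangentBundle 𝓘(ℝ, E) M)).2) = L := by
    ext w
    exact (congrFun (e.coe_linearMapAt_of_mem (R := ℝ) hm) w).symm
  have hL : ContMDiffAt 𝓘(ℝ, E) 𝓘(ℝ, E) ∞ L v := L.contMDiff v
  rw [← h] at hL
  exact hL

namespace IsSymplecticThickeningOn

variable {φ : TangentBundle 𝓘(ℝ, E) M → M} {O : Set (TangentBundle 𝓘(ℝ, E) M)}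

theorem congr {ψ : TangentBundle 𝓘(ℝ, E) M → M} (h : IsSymplecticThickeningOn Ω φ O)
    (hψ : EqOn ψ φ O) : IsSymplecticThickeningOn Ω ψ O := by
  have hev : ∀ (m : M) (v : E), ⟨m, v⟩ ∈ O → fibreDeriv ψ m v = fibreDeriv φ m v := by
    intro m v hv
    apply Filter.EventuallyEq.mfderiv_eq
    filter_upwards [(h.isOpen.preimage (continuous_fibreInclusion m)).mem_nhds hv] with w hw
    exact hψ hw
  refine ⟨h.isOpen, h.contMDiffOn.congr hψ, fun m v hv a b ↦ ?_, fun m hm ↦ ?_, fun m hm a ↦ ?_⟩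
  · rw [hev m v hv, hψ hv]
    exact h.preserves m v hv a b
  · rw [hψ hm, h.zero m hm]
  · rw [hev m 0 hm]
    exact h.fibreDeriv_zero m hm a

theorem mono {O' : Set (TangentBundle 𝓘(ℝ, E) M)} (h : IsSymplecticThickeningOn Ω φ O)
    (hO' : IsOpen O') (hsub : O' ⊆ O) : IsSymplecticThickeningOn Ω φ O' :=
  ⟨hO', h.contMDiffOn.mono hsub, fun m v hv ↦ h.preserves m v (hsub hv),
    fun m hm ↦ h.zero m (hsub hm), fun m hm ↦ h.fibreDeriv_zero m (hsub hm)⟩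

theorem iUnion {ι : Type*} {O : ι → Set (TangentBundle 𝓘(ℝ, E) M)}
    (h : ∀ i, IsSymplecticThickeningOn Ω φ (O i)) : IsSymplecticThickeningOn Ω φ (⋃ i, O i) := by
  refine ⟨isOpen_iUnion fun i ↦ (h i).isOpen,
    ContMDiffOn.iUnion_of_isOpen (fun i ↦ (h i).contMDiffOn) (fun i ↦ (h i).isOpen), ?_, ?_, ?_⟩
  · intro m v hv
    obtain ⟨i, hi⟩ := mem_iUnion.1 hv
    exact (h i).preserves m v hi
  · intro m hm
    obtain ⟨i, hi⟩ := mem_iUnion.1 hm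
    exact (h i).zero m hi
  · intro m hm
    obtain ⟨i, hi⟩ := mem_iUnion.1 hm
    exact (h i).fibreDeriv_zero m hi

/-- The derivative along the fibre, of a composition with charts. -/
theorem _root_.SymplecticThickening.IsDarbouxChart.isSymplecticThickeningOn
    (hc : IsDarbouxChart Ω B c) {f : E × E → E} {O : Set (E × E)} (hO : IsOpen O)
    (hf : IsSymplecticFamilyOn B f O) (hfc : MapsTo f O c.target) :
    IsSymplecticThickeningOn Ω (fun p ↦ c.symm (f (tanCoord c p)))
      (Bundle.TotalSpace.proj ⁻¹' c.source ∩ tanCoord c ⁻¹' O) := by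
  have hderiv : ∀ (m : M) (v : E), m ∈ c.source → tanCoord c ⟨m, v⟩ ∈ O → ∀ a : E,
      fibreDeriv (fun p ↦ c.symm (f (tanCoord c p))) m v a =
        paramDeriv c.symm (f (tanCoord c ⟨m, v⟩))
          (fderiv ℝ f (tanCoord c ⟨m, v⟩) (0, chartDeriv c m a)) := by
    intro m v hm hv a
    have h1 : HasFDerivAt (fun w : E ↦ tanCoord c (⟨m, w⟩ : TangentBundle 𝓘(ℝ, E) M))
        ((0 : E →L[ℝ] E).prod (chartDeriv c m)) v :=
      (hasFDerivAt_const (c m) v).prodMk (chartDeriv c m).hasFDerivAt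
    have h2 := ((hf.contDiffOn.contDiffAt (hO.mem_nhds hv)).differentiableAt
      (by simp)).hasFDerivAt.comp v h1
    have h3 := (hc.mdifferentiable.mdifferentiableAt_symm (hfc hv)).hasMFDerivAt.comp v
      h2.hasMFDerivAt
    exact congrArg (fun L : E →L[ℝ] E ↦ L a) h3.mfderiv
  have hopen : IsOpen (Bundle.TotalSpace.proj ⁻¹' c.source ∩ tanCoord c ⁻¹' O) :=
    hc.contMDiffOn_tanCoord.continuousOn.isOpen_inter_preimage
      (c.open_source.preimage (FiberBundle.continuous_proj E (TangentSpace 𝓘(ℝ, E)))) hO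
  have htan : ∀ m : M, tanCoord c (⟨m, (0 : E)⟩ : TangentBundle 𝓘(ℝ, E) M) = (c m, 0) := fun m ↦
    Prod.ext rfl (map_zero (chartDeriv c m))
  refine ⟨hopen, ?_, ?_, ?_, ?_⟩
  · exact hc.contMDiffOn_symm.comp (hf.contDiffOn.contMDiffOn.comp
      (hc.contMDiffOn_tanCoord.mono inter_subset_left) fun p hp ↦ hp.2) fun p hp ↦ hfc hp.2
  · rintro m v ⟨hm, hv⟩ a b
    rw [hderiv m v hm hv, hderiv m v hm hv, hc.symm_pullback _ (hfc hv), hf.preserves _ hv,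
      hc.pullback hm]
  · rintro m ⟨hm, hv⟩
    have hv' : (c m, (0 : E)) ∈ O := htan m ▸ hv
    change c.symm (f (tanCoord c ⟨m, (0 : E)⟩)) = m
    rw [htan, hf.zero _ hv', c.left_inv hm]
  · rintro m ⟨hm, hv⟩ a
    rw [hderiv m 0 hm hv]
    have hv' : (c m, (0 : E)) ∈ O := htan m ▸ hv
    rw [htan, hf.fderiv_zero _ hv', hf.zero _ hv', hc.paramDeriv_chartDeriv hm]

theorem mdifferentiableAt_fibre (h : IsSymplecticThickeningOn Ω φ O) {m : M} {v : E}
    (hv : (⟨m, v⟩ : TangentBundle 𝓘(ℝ, E) M) ∈ O) :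
    MDifferentiableAt 𝓘(ℝ, E) 𝓘(ℝ, E) (fun w : E ↦ φ ⟨m, w⟩) v :=
  ((h.contMDiffOn.contMDiffAt (h.isOpen.mem_nhds hv)).comp v
    (contMDiff_fibreInclusion m v)).mdifferentiableAt (by simp)

/-- Converse to `IsDarbouxChart.isSymplecticThickeningOn`: it brings a thickening into the form to
which Alexander's trick applies. The domain is given explicitly so that membership of points of the
zero section can be checked later. -/
theorem isSymplecticFamilyOn (h : IsSymplecticThickeningOn Ω φ O) (hc : IsDarbouxChart Ω B c) :
    ∃ O' : Set (E × E), IsOpen O' ∧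
      O' = (c.target ×ˢ univ) ∩ tanParam c ⁻¹' (O ∩ φ ⁻¹' c.source) ∧
      IsSymplecticFamilyOn B (fun q ↦ c (φ (tanParam c q))) O' := by
  have hO1 : IsOpen (O ∩ φ ⁻¹' c.source) :=
    h.contMDiffOn.continuousOn.isOpen_inter_preimage h.isOpen c.open_source
  have hO' : IsOpen ((c.target ×ˢ univ) ∩ tanParam c ⁻¹' (O ∩ φ ⁻¹' c.source)) :=
    hc.contMDiffOn_tanParam.continuousOn.isOpen_inter_preimage
      (c.open_target.prod isOpen_univ) hO1
  refine ⟨_, hO', rfl, ?_⟩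
  have hsmooth : ContDiffOn ℝ ∞ (fun q ↦ c (φ (tanParam c q)))
      ((c.target ×ˢ univ) ∩ tanParam c ⁻¹' (O ∩ φ ⁻¹' c.source)) := by
    rw [← contMDiffOn_iff_contDiffOn]
    exact hc.contMDiffOn.comp (h.contMDiffOn.comp
      (hc.contMDiffOn_tanParam.mono inter_subset_left) fun q hq ↦ hq.2.1) fun q hq ↦ hq.2.2
  have hderiv : ∀ q ∈ (c.target ×ˢ univ) ∩ tanParam c ⁻¹' (O ∩ φ ⁻¹' c.source), ∀ a : E,
      fderiv ℝ (fun q ↦ c (φ (tanParam c q))) q (0, a) = chartDeriv c (φ (tanParam c q))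
        (fibreDeriv φ (c.symm q.1) (paramDeriv c.symm q.1 q.2) (paramDeriv c.symm q.1 a)) := by
    rintro ⟨x, w⟩ hq a
    have h1 := ((hsmooth.contDiffAt (hO'.mem_nhds hq)).differentiableAt (by simp)).hasFDerivAt
    have h2 := h1.comp w (hasFDerivAt_prodMk_right x w)
    have h3 := ((hc.mdifferentiable.mdifferentiableAt hq.2.2).hasMFDerivAt.comp
      (paramDeriv c.symm x w) (h.mdifferentiableAt_fibre hq.2.1).hasMFDerivAt).comp w
      (paramDeriv c.symm x).hasFDerivAt.hasMFDerivAt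
    exact congrArg (fun L : E →L[ℝ] E ↦ L a) (hasMFDerivAt_unique h2.hasMFDerivAt h3)
  have htan : ∀ x : E, tanParam c (x, 0) = ⟨c.symm x, 0⟩ := fun x ↦ by
    simp only [tanParam, map_zero]
    rfl
  refine ⟨hsmooth, ?_, ?_, ?_⟩
  · intro q hq a b
    rw [hderiv q hq, hderiv q hq, hc.pullback hq.2.2, ← hc.symm_pullback q.1 hq.1.1]
    exact h.preserves _ _ hq.2.1 _ _
  · intro x hx
    have hx1 := hx.2.1
    rw [htan] at hx1 ⊢
    rw [h.zero _ hx1, c.right_inv hx.1.1]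
  · intro x hx a
    have hx1 := hx.2.1
    rw [hderiv _ hx, htan]
    rw [htan] at hx1
    rw [h.zero _ hx1, map_zero, h.fibreDeriv_zero _ hx1, hc.chartDeriv_paramDeriv hx.1.1]

end IsSymplecticThickeningOn

end Families

/-! ### Gluing thickenings over a finite cover. -/

section Gluing

universe u

variable {E : Type u} [NormedAddCommGroup E] [NormedSpace ℝ E]
variable {M : Type*} [TopologicalSpace M] [ChartedSpace E M] [IsManifold 𝓘(ℝ, E) ∞ M]
variable {Ω : M → E [⋀^Fin 2]→L[ℝ] ℝ} {B : E →L[ℝ] E →L[ℝ] ℝ} {c : OpenPartialHomeomorph M E}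

/-- `φ` is a symplectic thickening near the zero vector at `m`. -/
def IsSymplecticThickeningAt (Ω : M → E [⋀^Fin 2]→L[ℝ] ℝ) (φ : TangentBundle 𝓘(ℝ, E) M → M)
    (m : M) : Prop :=
  ∃ O, IsSymplecticThickeningOn Ω φ O ∧ (⟨m, (0 : E)⟩ : TangentBundle 𝓘(ℝ, E) M) ∈ O

theorem isSymplecticFamilyOn_add (B : E →L[ℝ] E →L[ℝ] ℝ) (O : Set (E × E)) :
    IsSymplecticFamilyOn B (fun q ↦ q.1 + q.2) O := by
  have h : ∀ q a : E × E, fderiv ℝ (fun q : E × E ↦ q.1 + q.2) q a = a.1 + a.2 := by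
    intro q a
    have h1 : HasFDerivAt (fun q : E × E ↦ q.1 + q.2) _ q :=
      (hasFDerivAt_fst (𝕜 := ℝ) (p := q)).add (hasFDerivAt_snd (𝕜 := ℝ) (p := q))
    rw [h1.fderiv]
    rfl
  refine ⟨(contDiff_fst.add contDiff_snd).contDiffOn, fun q _ a b ↦ ?_, fun x _ ↦ add_zero x,
    fun x _ a ↦ ?_⟩
  · rw [h, h, zero_add, zero_add]
  · rw [h, zero_add]

open Classical in
/-- The modification of `φ` by a Darboux chart `c`, where the function `s` differs from `1`. -/
noncomputable def glueChart (φ : TangentBundle 𝓘(ℝ, E) M → M) (c : OpenPartialHomeomorph M E)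
    (s : M → ℝ) (p : TangentBundle 𝓘(ℝ, E) M) : M :=
  if s p.1 = 1 then φ p
  else c.symm (alexander (fun q ↦ c (φ (tanParam c q))) (s ∘ c.symm) (tanCoord c p))

theorem isOpen_proj_preimage {N : Set M} (hN : IsOpen N) :
    IsOpen ((Bundle.TotalSpace.proj : TangentBundle 𝓘(ℝ, E) M → M) ⁻¹' N) :=
  hN.preimage (FiberBundle.continuous_proj E (TangentSpace 𝓘(ℝ, E)))

theorem tanCoord_zero (c : OpenPartialHomeomorph M E) (m : M) :
    tanCoord c (⟨m, (0 : E)⟩ : TangentBundle 𝓘(ℝ, E) M) = (c m, 0) :=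
  Prod.ext rfl (map_zero (chartDeriv c m))

/-- The glued map is unchanged away from the chart. -/
theorem IsSymplecticThickeningAt.glueChart_of_eventuallyEq_one
    {φ : TangentBundle 𝓘(ℝ, E) M → M} {m : M} (hφ : IsSymplecticThickeningAt Ω φ m) {s : M → ℝ}
    (hs : s =ᶠ[𝓝 m] 1) : IsSymplecticThickeningAt Ω (glueChart φ c s) m := by
  obtain ⟨O, hO, hm⟩ := hφ
  obtain ⟨N, hNs, hN, hmN⟩ := mem_nhds_iff.1 hs
  refine ⟨O ∩ Bundle.TotalSpace.proj ⁻¹' N, ?_, hm, hmN⟩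
  refine (hO.mono (hO.isOpen.inter (isOpen_proj_preimage hN)) inter_subset_left).congr ?_
  intro p hp
  have : s p.1 = 1 := hNs hp.2
  simp [glueChart, this]

/-- Where `s = 0` the glued map is affine in the chart. -/
theorem IsDarbouxChart.isSymplecticThickeningAt_glueChart (hc : IsDarbouxChart Ω B c)
    (φ : TangentBundle 𝓘(ℝ, E) M → M) {m : M} (hm : m ∈ c.source) {s : M → ℝ}
    (hs : s =ᶠ[𝓝 m] 0) : IsSymplecticThickeningAt Ω (glueChart φ c s) m := by
  obtain ⟨N, hNs, hN, hmN⟩ := mem_nhds_iff.1 hs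
  set O : Set (E × E) := {q | q.1 + q.2 ∈ c.target}
  have hO : IsOpen O := c.open_target.preimage (continuous_fst.add continuous_snd)
  have h := hc.isSymplecticThickeningOn hO (isSymplecticFamilyOn_add B O) fun q hq ↦ hq
  refine ⟨_, (h.mono (h.isOpen.inter (isOpen_proj_preimage hN)) inter_subset_left).congr ?_,
    ⟨hm, ?_⟩, hmN⟩
  · intro p hp
    have hsp : s p.1 = 0 := hNs hp.2
    have hsp' : (s ∘ c.symm) (tanCoord c p).1 = 0 := by
      change s (c.symm (c p.1)) = 0
      rw [c.left_inv hp.1.1, hsp]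
    simp only [glueChart, hsp, zero_ne_one, if_false, alexander, hsp', if_true]
  · change tanCoord c ⟨m, (0 : E)⟩ ∈ O
    rw [tanCoord_zero]
    simpa [O] using c.map_source hm

/-- For `s = 1` Alexander's family is `f`, that is `φ` read in the chart, so the two branches of
`glueChart` agree. Near the zero vector at `m` the glued map is therefore the rescaled family
throughout. -/
theorem IsSymplecticThickeningAt.glueChart_of_mem [CompleteSpace E]
    {φ : TangentBundle 𝓘(ℝ, E) M → M} {m : M} (hφ : IsSymplecticThickeningAt Ω φ m)
    (hc : IsDarbouxChart Ω B c) (hm : m ∈ c.source) {s : M → ℝ}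
    (hs : ContMDiff 𝓘(ℝ, E) 𝓘(ℝ, ℝ) ∞ s) (hs01 : ∀ m, s m ∈ Icc (0 : ℝ) 1) :
    IsSymplecticThickeningAt Ω (glueChart φ c s) m := by
  obtain ⟨O, hO, hmO⟩ := hφ
  obtain ⟨O₁, hO₁, hO₁e, hf⟩ := hO.isSymplecticFamilyOn hc
  set f : E × E → E := fun q ↦ c (φ (tanParam c q))
  have hφm : φ ⟨m, (0 : E)⟩ = m := hO.zero m hmO
  have hcm : tanParam c (c m, 0) = ⟨m, (0 : E)⟩ := by
    rw [← tanCoord_zero, hc.tanParam_tanCoord hm]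
  have hmem : (c m, (0 : E)) ∈ O₁ := by
    rw [hO₁e]
    refine ⟨⟨c.map_source hm, trivial⟩, ?_⟩
    rw [mem_preimage, hcm]
    exact ⟨hmO, by rw [mem_preimage, hφm]; exact hm⟩
  have hs' : ContDiffOn ℝ ∞ (s ∘ c.symm) c.target :=
    (hs.comp_contMDiffOn hc.contMDiffOn_symm).contDiffOn
  obtain ⟨O₂, hO₂, hmem₂, hal⟩ := hf.alexander hO₁ hmem c.open_target (c.map_source hm) hs'
    fun x ↦ hs01 _
  set O₃ : Set (E × E) := O₂ ∩ alexander f (s ∘ c.symm) ⁻¹' c.target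
  have hO₃ : IsOpen O₃ := hal.contDiffOn.continuousOn.isOpen_inter_preimage hO₂ c.open_target
  have hal₃ : IsSymplecticFamilyOn B (alexander f (s ∘ c.symm)) O₃ :=
    ⟨hal.contDiffOn.mono inter_subset_left, fun p hp ↦ hal.preserves p hp.1,
      fun x hx ↦ hal.zero x hx.1, fun x hx ↦ hal.fderiv_zero x hx.1⟩
  have h := hc.isSymplecticThickeningOn hO₃ hal₃ fun q hq ↦ hq.2
  have hO₄ : IsOpen (O ∩ φ ⁻¹' c.source) :=
    hO.contMDiffOn.continuousOn.isOpen_inter_preimage hO.isOpen c.open_source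
  refine ⟨_, (h.mono (h.isOpen.inter hO₄) inter_subset_left).congr ?_,
    ⟨hm, ?_⟩, hmO, ?_⟩
  · intro p hp
    by_cases hsp : s p.1 = 1
    · have hsp' : (s ∘ c.symm) (tanCoord c p).1 = 1 := by
        change s (c.symm (c p.1)) = 1
        rw [c.left_inv hp.1.1, hsp]
      simp only [glueChart, hsp, if_true, alexander, hsp', one_ne_zero, if_false, inv_one, one_smul,
        add_sub_cancel]
      change φ p = c.symm (c (φ (tanParam c (tanCoord c p))))
      rw [hc.tanParam_tanCoord hp.1.1, c.left_inv hp.2.2]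
    · simp only [glueChart, hsp, if_false]
      rfl
  · rw [mem_preimage, tanCoord_zero]
    refine ⟨hmem₂, ?_⟩
    rw [mem_preimage, hal.zero _ hmem₂]
    exact c.map_source hm
  · rw [mem_preimage, hφm]
    exact hm

/-- Every point has a neighbourhood to which each symplectic thickening can be extended. -/
theorem exists_nhds_extension [FiniteDimensional ℝ E] [T2Space M]
    (hΩ : IsSymplecticForm (E := E) (M := M) Ω) (m₀ : M) :
    ∃ N ∈ 𝓝 m₀, ∀ φ : TangentBundle 𝓘(ℝ, E) M → M, ∃ φ' : TangentBundle 𝓘(ℝ, E) M → M,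
      ∀ m, (IsSymplecticThickeningAt Ω φ m ∨ m ∈ N) → IsSymplecticThickeningAt Ω φ' m := by
  have : CompleteSpace E := FiniteDimensional.complete ℝ E
  obtain ⟨B, c, hm₀, hc⟩ := exists_isDarbouxChart Ω hΩ m₀
  obtain ⟨ρ, -, hρ⟩ := (SmoothBumpFunction.nhds_basis_tsupport (I := 𝓘(ℝ, E)) m₀).mem_iff.1
    (c.open_source.mem_nhds hm₀)
  -- On `N`, where `s = 0`, the glued map is affine whatever `φ` was; off `tsupport ρ`, where `s =
  -- 1`, it is `φ`. On the rest of the support it is a thickening wherever `φ` was one.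
  set s : M → ℝ := fun m ↦ 1 - ρ m
  have hs : ContMDiff 𝓘(ℝ, E) 𝓘(ℝ, ℝ) ∞ s := contMDiff_const.sub ρ.contMDiff
  have hs01 : ∀ m, s m ∈ Icc (0 : ℝ) 1 := fun m ↦
    ⟨sub_nonneg.2 ρ.le_one, sub_le_self _ ρ.nonneg⟩
  obtain ⟨N, hN1, hN, hmN⟩ := mem_nhds_iff.1 ρ.eventuallyEq_one
  have hs0 : ∀ m ∈ N, s =ᶠ[𝓝 m] 0 := by
    intro m hm
    filter_upwards [hN.mem_nhds hm] with m' hm'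
    have : ρ m' = 1 := hN1 hm'
    simp [s, this]
  refine ⟨N, hN.mem_nhds hmN, fun φ ↦ ⟨glueChart φ c s, fun m hm ↦ ?_⟩⟩
  rcases hm with hφ | hm
  · by_cases hmt : m ∈ tsupport ρ
    · exact hφ.glueChart_of_mem hc (hρ hmt) hs hs01
    · refine hφ.glueChart_of_eventuallyEq_one ?_
      filter_upwards [(isClosed_tsupport ρ).isOpen_compl.mem_nhds hmt] with m' hm'
      simp [s, image_eq_zero_of_notMem_tsupport hm']
  · refine hc.isSymplecticThickeningAt_glueChart φ ?_ (hs0 m hm)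
    apply hρ
    apply subset_tsupport
    have : ρ m = 1 := hN1 hm
    simp [this]

/-- Symplectic thickenings exist on compact symplectic manifolds. -/
theorem exists_isSymplecticThickeningOn [FiniteDimensional ℝ E] [T2Space M] [CompactSpace M]
    (hΩ : IsSymplecticForm (E := E) (M := M) Ω) :
    ∃ (φ : TangentBundle 𝓘(ℝ, E) M → M) (O : Set (TangentBundle 𝓘(ℝ, E) M)),
      IsSymplecticThickeningOn Ω φ O ∧ ∀ m : M, ⟨m, (0 : E)⟩ ∈ O := by
  -- The neighbourhoods do not depend on the map being extended, so a finite subcover can be used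
  -- for successive modifications.
  choose N hN hext using exists_nhds_extension (E := E) hΩ
  have key : ∀ t : Finset M, ∃ φ : TangentBundle 𝓘(ℝ, E) M → M,
      ∀ i ∈ t, ∀ m ∈ N i, IsSymplecticThickeningAt Ω φ m := by
    classical
    intro t
    induction t using Finset.induction_on with
    -- Any map serves as a start, since nothing is required of it yet.
    | empty => exact ⟨fun p ↦ p.1, by simp⟩
    | insert a t _ ih =>
      obtain ⟨φ, hφ⟩ := ih
      obtain ⟨φ', hφ'⟩ := hext a φ
      refine ⟨φ', fun i hi m hm ↦ ?_⟩
      rcases Finset.mem_insert.1 hi with rfl | hi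
      · exact hφ' m (Or.inr hm)
      · exact hφ' m (Or.inl (hφ i hi m hm))
  obtain ⟨t, ht⟩ := CompactSpace.elim_nhds_subcover N hN
  obtain ⟨φ, hφ⟩ := key t
  have hall : ∀ m, IsSymplecticThickeningAt Ω φ m := by
    intro m
    have : m ∈ ⋃ x ∈ t, N x := by
      rw [ht]; trivial
    obtain ⟨i, hi, hm⟩ := mem_iUnion₂.1 this
    exact hφ i hi m hm
  choose O hO hm using hall
  exact ⟨φ, ⋃ m, O m, IsSymplecticThickeningOn.iUnion hO, fun m ↦ mem_iUnion.2 ⟨m, hm m⟩⟩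

end Gluing

/-! ### Unitary linear algebra. -/

section Frames

variable {E : Type*} [NormedAddCommGroup E] [NormedSpace ℝ E]

/-- Partial unitary bases of a real vector space with a compatible complex structure. -/
theorem exists_unitary_family [FiniteDimensional ℝ E] {n : ℕ} (hn : Module.finrank ℝ E = 2 * n)
    {B : E →L[ℝ] E →L[ℝ] ℝ} {J : E →L[ℝ] E} (halt : ∀ a b, B a b = -B b a)
    (hJ : ∀ v, J (J v) = -v) (hinv : ∀ v w, B (J v) (J w) = B v w)
    (hpos : ∀ v, v ≠ 0 → 0 < B v (J v)) {k : ℕ} (hk : k ≤ n) :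
    ∃ e : Fin k → E, ∀ i j, B (e i) (e j) = 0 ∧ B (e i) (J (e j)) = if i = j then 1 else 0 := by
  induction k with
  | zero => exact ⟨Fin.elim0, fun i ↦ i.elim0⟩
  | succ k ih =>
    obtain ⟨e, he⟩ := ih (Nat.le_of_succ_le hk)
    -- Orthogonality to the `e i` and `J (e i)` imposes `2 * k` linear conditions in dimension `2 *
    -- n > 2 * k`, so a nonzero `v` satisfies them; it is then normalized by the square root of `B v
    -- (J v)`.
    set L : E →ₗ[ℝ] (Fin k → ℝ) × (Fin k → ℝ) :=
      (LinearMap.pi fun i ↦ (B (e i)).toLinearMap).prod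
        (LinearMap.pi fun i ↦ ((B (e i)).comp J).toLinearMap)
    have hker : LinearMap.ker L ≠ ⊥ := by
      apply LinearMap.ker_ne_bot_of_finrank_lt
      rw [Module.finrank_prod, Module.finrank_fin_fun, hn]
      omega
    obtain ⟨v, hv, hv0⟩ := (Submodule.ne_bot_iff _).1 hker
    have hLv : L v = 0 := hv
    have h1 : ∀ i, B (e i) v = 0 := fun i ↦ congrFun (congrArg Prod.fst hLv) i
    have h2 : ∀ i, B (e i) (J v) = 0 := fun i ↦ congrFun (congrArg Prod.snd hLv) i
    have h3 : ∀ i, B v (J (e i)) = 0 := fun i ↦ by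
      have h := hinv v (J (e i))
      rw [hJ, map_neg, halt, neg_neg] at h
      rw [← h, h2]
    set r : ℝ := B v (J v)
    have hr : 0 < r := hpos v hv0
    have hvv : ∀ a, B a a = 0 := fun a ↦ by linarith [halt a a]
    refine ⟨Fin.cons ((Real.sqrt r)⁻¹ • v) e, fun i j ↦ ?_⟩
    refine Fin.cases ?_ (fun i ↦ ?_) i <;> refine Fin.cases ?_ (fun j ↦ ?_) j
    · refine ⟨hvv _, ?_⟩
      simp only [Fin.cons_zero, map_smul, _root_.smul_apply, smul_eq_mul, if_true]
      change (Real.sqrt r)⁻¹ * ((Real.sqrt r)⁻¹ * r) = 1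
      have := Real.mul_self_sqrt hr.le
      have hs : Real.sqrt r ≠ 0 := (Real.sqrt_pos.2 hr).ne'
      field_simp
      linarith
    · have : (0 : Fin (k + 1)) ≠ j.succ := (Fin.succ_ne_zero j).symm
      simp [h3, halt v (e j), h1, this]
    · simp [h1, h2]
    · simpa using he i j

/-- Unitary frames exist. -/
theorem exists_unitary_frame [FiniteDimensional ℝ E] {n : ℕ} (hn : Module.finrank ℝ E = 2 * n)
    {B : E →L[ℝ] E →L[ℝ] ℝ} {J : E →L[ℝ] E} (halt : ∀ a b, B a b = -B b a)
    (hJ : ∀ v, J (J v) = -v) (hinv : ∀ v w, B (J v) (J w) = B v w)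
    (hpos : ∀ v, v ≠ 0 → 0 < B v (J v)) :
    ∃ u : EuclideanSpace ℂ (Fin n) ≃L[ℝ] E, (∀ z, u (Complex.I • z) = J (u z)) ∧
      ∀ z w, B (u z) (u w) = stdForm n z w := by
  obtain ⟨e, he⟩ := exists_unitary_family hn halt hJ hinv hpos le_rfl
  have hJe : ∀ i j, B (J (e i)) (e j) = if i = j then -1 else 0 := fun i j ↦ by
    rw [halt, (he j i).2]
    by_cases h : i = j <;> simp [h, eq_comm]
  let U : EuclideanSpace ℂ (Fin n) →ₗ[ℝ] E :=
    { toFun := fun z ↦ ∑ j, ((z j).re • e j + (z j).im • J (e j))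
      map_add' := fun z w ↦ by
        rw [← Finset.sum_add_distrib]
        refine Finset.sum_congr rfl fun j _ ↦ ?_
        simp only [PiLp.add_apply, Complex.add_re, Complex.add_im, add_smul]
        abel
      map_smul' := fun c z ↦ by
        rw [RingHom.id_apply, Finset.smul_sum]
        refine Finset.sum_congr rfl fun j _ ↦ ?_
        simp [mul_smul] }
  have hU : ∀ z, U z = ∑ j, ((z j).re • e j + (z j).im • J (e j)) := fun _ ↦ rfl
  have hform : ∀ z w, B (U z) (U w) = stdForm n z w := by
    intro z w
    have h1 : ∀ j, B ((z j).re • e j + (z j).im • J (e j)) (U w) =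
        (z j).re * (w j).im - (z j).im * (w j).re := by
      intro j
      rw [hU, map_sum]
      simp only [map_add, map_smul, _root_.add_apply, _root_.smul_apply, smul_eq_mul, hinv,
        fun i j ↦ (he i j).1, fun i j ↦ (he i j).2, hJe]
      simp [Finset.sum_add_distrib, sub_eq_add_neg]
      ring
    rw [hU z, map_sum, _root_.sum_apply, stdForm]
    exact Finset.sum_congr rfl fun j _ ↦ h1 j
  have hI : ∀ z, U (Complex.I • z) = J (U z) := by
    intro z
    rw [hU, hU, map_sum]
    refine Finset.sum_congr rfl fun j _ ↦ ?_
    simp [hJ]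
    abel
  have hinj : Function.Injective U := by
    rw [← LinearMap.ker_eq_bot, LinearMap.ker_eq_bot']
    intro z hz
    have h0 : ∀ j, z j = 0 := by
      have h1 : stdForm n z (Complex.I • z) = 0 := by rw [← hform, hz]; simp
      have h2 : ∑ j, ((z j).re ^ 2 + (z j).im ^ 2) = 0 := by
        rw [← h1, stdForm]
        refine Finset.sum_congr rfl fun j _ ↦ ?_
        simp
        ring
      intro j
      have h3 := (Finset.sum_eq_zero_iff_of_nonneg (fun j _ ↦ by positivity)).1 h2 j
        (Finset.mem_univ j)
      apply Complex.ext <;> simp <;> nlinarith [sq_nonneg (z j).re, sq_nonneg (z j).im]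
    ext j
    exact h0 j
  have hdim : Module.finrank ℝ (EuclideanSpace ℂ (Fin n)) = Module.finrank ℝ E := by
    rw [hn, ← Module.finrank_mul_finrank ℝ ℂ, Complex.finrank_real_complex,
      finrank_euclideanSpace_fin]
  have : FiniteDimensional ℝ (EuclideanSpace ℂ (Fin n)) := Module.Finite.trans ℂ _
  exact ⟨(LinearEquiv.ofInjectiveOfFinrankEq U hinj hdim).toContinuousLinearEquiv, hI, hform⟩

/-- Through a unitary frame this matches the Euclidean norm with the metric, hence `stdBall n ε`
with a fibre of the ball bundle. -/
theorem stdForm_I_smul (n : ℕ) (z : EuclideanSpace ℂ (Fin n)) :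
    stdForm n z (Complex.I • z) = ‖z‖ ^ 2 := by
  rw [EuclideanSpace.norm_sq_eq, stdForm]
  refine Finset.sum_congr rfl fun j _ ↦ ?_
  rw [← Complex.normSq_eq_norm_sq, Complex.normSq_apply]
  simp

end Frames

/-! ### A uniform radius of definition and injectivity. -/

section Radius

universe u

variable {E : Type u} [NormedAddCommGroup E] [NormedSpace ℝ E]
variable {M : Type*} [TopologicalSpace M] [ChartedSpace E M] [IsManifold 𝓘(ℝ, E) ∞ M]
variable {Ω : M → E [⋀^Fin 2]→L[ℝ] ℝ} {J : M → E →L[ℝ] E}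

/-- In a Darboux chart `Ω` is the constant `B`, so continuity of the metric reduces to that of `J`
as a map of the tangent bundle. -/
theorem IsDarbouxChart.continuousOn_metric {B : E →L[ℝ] E →L[ℝ] ℝ} {c : OpenPartialHomeomorph M E}
    (hc : IsDarbouxChart Ω B c) (hJ : IsCompatibleAlmostComplex (E := E) (M := M) Ω J) :
    ContinuousOn (fun q : E × E ↦ Ω (c.symm q.1)
      ![paramDeriv c.symm q.1 q.2, J (c.symm q.1) (paramDeriv c.symm q.1 q.2)])
      (c.target ×ˢ univ) := by
  have hJT : Continuous (fun p : TangentBundle 𝓘(ℝ, E) M ↦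
      (⟨p.1, J p.1 p.2⟩ : TangentBundle 𝓘(ℝ, E) M)) :=
    ((hJ.smooth.comp (Bundle.contMDiff_proj (TangentSpace 𝓘(ℝ, E)))).clm_bundle_apply
      (v := fun p : TangentBundle 𝓘(ℝ, E) M ↦ p.2) contMDiff_id).continuous
  have h1 : ContinuousOn (fun q : E × E ↦ (⟨(tanParam c q).1, J (tanParam c q).1
      (tanParam c q).2⟩ : TangentBundle 𝓘(ℝ, E) M)) (c.target ×ˢ univ) :=
    hJT.comp_continuousOn hc.contMDiffOn_tanParam.continuousOn
  have h2 := hc.contMDiffOn_tanCoord.continuousOn.comp h1 fun q hq ↦ c.map_target hq.1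
  have h3 : ContinuousOn (fun q : E × E ↦ B q.2 (tanCoord c (⟨(tanParam c q).1,
      J (tanParam c q).1 (tanParam c q).2⟩ : TangentBundle 𝓘(ℝ, E) M)).2) (c.target ×ˢ univ) :=
    (B.continuous.comp continuous_snd).continuousOn.clm_apply (continuous_snd.comp_continuousOn h2)
  refine h3.congr fun q hq ↦ ?_
  rw [← hc.pullback (c.map_target hq.1), hc.chartDeriv_paramDeriv hq.1]
  rfl

/-- Tangent vectors that are small for the metric are close to the zero section. -/
theorem exists_nhds_metric_lt [FiniteDimensional ℝ E]
    (hΩ : IsSymplecticForm (E := E) (M := M) Ω)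
    (hJ : IsCompatibleAlmostComplex (E := E) (M := M) Ω J) {m₀ : M}
    {W : Set (TangentBundle 𝓘(ℝ, E) M)} (hW : W ∈ 𝓝 (⟨m₀, (0 : E)⟩ : TangentBundle 𝓘(ℝ, E) M)) :
    ∃ N ∈ 𝓝 m₀, ∃ δ > 0, ∀ m ∈ N, ∀ v : E, Ω m ![v, J m v] < δ → ⟨m, v⟩ ∈ W := by
  obtain ⟨B, c, hm₀, hc⟩ := exists_isDarbouxChart Ω hΩ m₀
  have htan : tanCoord c (⟨m₀, (0 : E)⟩ : TangentBundle 𝓘(ℝ, E) M) = (c m₀, 0) :=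
    Prod.ext rfl (map_zero (chartDeriv c m₀))
  have hpar : tanParam c (c m₀, 0) = ⟨m₀, (0 : E)⟩ := by
    rw [← htan, hc.tanParam_tanCoord hm₀]
  have hnhds : c.target ×ˢ univ ∈ 𝓝 (c m₀, (0 : E)) :=
    (c.open_target.prod isOpen_univ).mem_nhds ⟨c.map_source hm₀, mem_univ _⟩
  have hW' : tanParam c ⁻¹' W ∩ c.target ×ˢ univ ∈ 𝓝 (c m₀, (0 : E)) :=
    inter_mem ((hc.contMDiffOn_tanParam.continuousOn.continuousAt hnhds).preimage_mem_nhds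
      (by rw [hpar]; exact hW)) hnhds
  obtain ⟨r, hr, hrW⟩ := Metric.nhds_basis_closedBall.mem_iff.1 hW'
  rw [← closedBall_prod_same] at hrW
  set G : E × E → ℝ := fun q ↦ Ω (c.symm q.1)
    ![paramDeriv c.symm q.1 q.2, J (c.symm q.1) (paramDeriv c.symm q.1 q.2)] with hG
  have hsub : Metric.closedBall (c m₀) r ×ˢ Metric.sphere (0 : E) r ⊆ c.target ×ˢ univ :=
    fun q hq ↦ (hrW ⟨hq.1, Metric.sphere_subset_closedBall hq.2⟩).2
  have hprop : ProperSpace E := FiniteDimensional.proper ℝ E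
  -- `δ` is a positive lower bound of the metric on the compact set of vectors with `‖w‖ = r`. As
  -- the metric is quadratic in `w`, a value below `δ` forces `‖w‖ < r`.
  obtain ⟨δ, hδ, hGδ⟩ := ((isCompact_closedBall (c m₀) r).prod
    (isCompact_sphere (0 : E) r)).exists_forall_le' ((hc.continuousOn_metric hJ).mono hsub)
    (a := 0) (by
      rintro ⟨x, w⟩ hq
      refine hJ.pos _ _ fun h0 ↦ ?_
      have h1 := hc.chartDeriv_paramDeriv (hsub hq).1 w
      have h2 : w = 0 := by
        rw [← h1]
        exact (congrArg (chartDeriv c (c.symm x)) h0).trans (map_zero _)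
      have h3 : ‖w‖ = r := mem_sphere_zero_iff_norm.1 hq.2
      rw [h2, norm_zero] at h3
      exact hr.ne h3)
  have hhom : ∀ (x w : E) (t : ℝ), G (x, t • w) = t ^ 2 * G (x, w) := by
    intro x w t
    simp only [hG, ← twoFormCurry_apply, map_smul, _root_.smul_apply, smul_eq_mul]
    ring
  refine ⟨c.source ∩ c ⁻¹' Metric.closedBall (c m₀) r, inter_mem (c.open_source.mem_nhds hm₀)
    ((c.continuousAt hm₀).preimage_mem_nhds (Metric.closedBall_mem_nhds _ hr)), δ, hδ, ?_⟩
  rintro m ⟨hm, hmr⟩ v hv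
  set w := chartDeriv c m v with hw
  have hGv : G (c m, w) = Ω m ![v, J m v] := by
    simp only [hG, hw]
    rw [hc.paramDeriv_chartDeriv hm, c.left_inv hm]
  have hwr : ‖w‖ < r := by
    by_contra! hle
    have hw0 : 0 < ‖w‖ := hr.trans_le hle
    have h1 := hGδ (c m, (r / ‖w‖) • w) ⟨hmr, by
      rw [mem_sphere_zero_iff_norm, norm_smul, norm_div, norm_norm, Real.norm_of_nonneg hr.le,
        div_mul_cancel₀ _ hw0.ne']⟩
    change δ ≤ G _ at h1
    rw [hhom, hGv] at h1
    have h2 : (r / ‖w‖) ^ 2 ≤ 1 := pow_le_one₀ (by positivity) ((div_le_one hw0).2 hle)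
    have h3 : 0 ≤ Ω m ![v, J m v] := by
      by_contra! hneg
      nlinarith [sq_nonneg (r / ‖w‖)]
    nlinarith
  have := (hrW (show (c m, w) ∈ _ from ⟨hmr, mem_closedBall_zero_iff.2 hwr.le⟩)).1
  have h4 := hc.tanParam_tanCoord (p := ⟨m, v⟩) hm
  exact h4 ▸ this

/-- A symplectic thickening is injective on the fibres near the zero section. -/
theorem IsSymplecticThickeningOn.exists_nhds_injOn [FiniteDimensional ℝ E]
    {φ : TangentBundle 𝓘(ℝ, E) M → M} {O : Set (TangentBundle 𝓘(ℝ, E) M)}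
    (hΩ : IsSymplecticForm (E := E) (M := M) Ω) (hφ : IsSymplecticThickeningOn Ω φ O) {m₀ : M}
    (h₀ : ⟨m₀, (0 : E)⟩ ∈ O) :
    ∃ W ∈ 𝓝 (⟨m₀, (0 : E)⟩ : TangentBundle 𝓘(ℝ, E) M), W ⊆ O ∧
      ∀ (m : M) (v v' : E), ⟨m, v⟩ ∈ W → ⟨m, v'⟩ ∈ W → φ ⟨m, v⟩ = φ ⟨m, v'⟩ → v = v' := by
  obtain ⟨B, c, hm₀, hc⟩ := exists_isDarbouxChart Ω hΩ m₀
  obtain ⟨O', hO', hO'eq, hf⟩ := hφ.isSymplecticFamilyOn hc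
  have htan : tanCoord c (⟨m₀, (0 : E)⟩ : TangentBundle 𝓘(ℝ, E) M) = (c m₀, 0) :=
    Prod.ext rfl (map_zero (chartDeriv c m₀))
  have hpar : tanParam c (c m₀, 0) = ⟨m₀, (0 : E)⟩ := by
    rw [← htan, hc.tanParam_tanCoord hm₀]
  have hx : (c m₀, (0 : E)) ∈ O' := by
    rw [hO'eq]
    refine ⟨⟨c.map_source hm₀, mem_univ _⟩, ?_⟩
    rw [mem_preimage, hpar]
    exact ⟨h₀, mem_of_eq_of_mem (s := c.source) (hφ.zero _ h₀) hm₀⟩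
  -- Near `(c m₀, 0)` differences of values are within half of `‖q - q'‖` of the linear part. For
  -- `q, q'` in one fibre the linear part has norm `‖q - q'‖`, so equal values force `q = q'`.
  have hstrict := (hf.contDiffOn.contDiffAt (hO'.mem_nhds hx)).hasStrictFDerivAt
    (n := ∞) (by simp)
  obtain ⟨s, hs, happ⟩ := hstrict.approximates_deriv_on_nhds (c := 1 / 2) (Or.inr (by norm_num))
  have hsrc : Bundle.TotalSpace.proj ⁻¹' c.source ∈
      𝓝 (⟨m₀, (0 : E)⟩ : TangentBundle 𝓘(ℝ, E) M) :=
    (c.open_source.preimage (FiberBundle.continuous_proj E (TangentSpace 𝓘(ℝ, E)))).mem_nhds hm₀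
  refine ⟨Bundle.TotalSpace.proj ⁻¹' c.source ∩ tanCoord c ⁻¹' (s ∩ O'), inter_mem hsrc
    ((hc.contMDiffOn_tanCoord.continuousOn.continuousAt hsrc).preimage_mem_nhds ?_), ?_, ?_⟩
  · rw [htan]
    exact inter_mem hs (hO'.mem_nhds hx)
  · rintro p ⟨hp, -, hp'⟩
    rw [hO'eq] at hp'
    have := hp'.2.1
    rwa [hc.tanParam_tanCoord hp] at this
  · rintro m v v' ⟨hm, hv, -⟩ ⟨-, hv', -⟩ heq
    have h1 := happ _ hv _ hv'
    beta_reduce at h1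
    rw [hc.tanParam_tanCoord hm, hc.tanParam_tanCoord (p := ⟨m, v'⟩) hm, heq, sub_self, zero_sub,
      norm_neg] at h1
    have h2 : tanCoord c (⟨m, v⟩ : TangentBundle 𝓘(ℝ, E) M) - tanCoord c ⟨m, v'⟩ =
        (0, chartDeriv c m (v - v')) :=
      Prod.ext (sub_self (c m)) (map_sub (chartDeriv c m) v v').symm
    rw [h2, hf.fderiv_zero _ hx, Prod.norm_mk, norm_zero, max_eq_right (norm_nonneg _)] at h1
    have h3 : ‖chartDeriv c m (v - v')‖ = 0 := by
      have := norm_nonneg (chartDeriv c m (v - v'))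
      have h0 : ((1 / 2 : NNReal) : ℝ) = 1 / 2 := by norm_num
      rw [h0] at h1
      linarith
    have h4 := hc.paramDeriv_chartDeriv hm (v - v')
    rw [norm_eq_zero.1 h3, map_zero] at h4
    exact (sub_eq_zero.1 h4.symm)

/-- On a compact manifold, a neighbourhood of the zero section contains a ball bundle on whose fibres
a symplectic thickening is injective. -/
theorem IsSymplecticThickeningOn.exists_radius [FiniteDimensional ℝ E] [CompactSpace M]
    {φ : TangentBundle 𝓘(ℝ, E) M → M} {O : Set (TangentBundle 𝓘(ℝ, E) M)}
    (hΩ : IsSymplecticForm (E := E) (M := M) Ω)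
    (hJ : IsCompatibleAlmostComplex (E := E) (M := M) Ω J)
    (hφ : IsSymplecticThickeningOn Ω φ O) (h₀ : ∀ m, ⟨m, (0 : E)⟩ ∈ O) :
    ∃ ε > 0, ∀ m : M,
      (∀ v : E, Ω m ![v, J m v] < ε ^ 2 → (⟨m, v⟩ : TangentBundle 𝓘(ℝ, E) M) ∈ O) ∧
      InjOn (fun v : E ↦ φ ⟨m, v⟩) {v | Ω m ![v, J m v] < ε ^ 2} := by
  choose W hW hWO hWinj using fun m ↦ hφ.exists_nhds_injOn hΩ (h₀ m)
  choose N hN δ hδ hlt using fun m ↦ exists_nhds_metric_lt hΩ hJ (hW m)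
  obtain ⟨t, ht⟩ := CompactSpace.elim_nhds_subcover N hN
  have hev : ∀ᶠ ε : ℝ in 𝓝[>] 0, ∀ i ∈ t, ε ^ 2 < δ i := by
    rw [Filter.eventually_all_finset]
    intro i _
    refine eventually_nhdsWithin_of_eventually_nhds
      ((continuous_pow 2).continuousAt.eventually_lt continuousAt_const ?_)
    simpa using hδ i
  obtain ⟨ε, hε, hε0⟩ := (hev.and self_mem_nhdsWithin).exists
  refine ⟨ε, hε0, fun m ↦ ?_⟩
  have hm : m ∈ ⋃ x ∈ t, N x := by
    rw [ht]; trivial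
  obtain ⟨i, hi, hmi⟩ := mem_iUnion₂.1 hm
  have hmem : ∀ v : E, Ω m ![v, J m v] < ε ^ 2 → (⟨m, v⟩ : TangentBundle 𝓘(ℝ, E) M) ∈ W i :=
    fun v hv ↦ hlt i m hmi v (hv.trans (hε i hi))
  exact ⟨fun v hv ↦ hWO i (hmem v hv),
    fun v hv v' hv' h ↦ hWinj i m v v' (hmem v hv) (hmem v' hv') h⟩

end Radius

/-! ### Injective local diffeomorphisms are smooth embeddings. -/

section Embedding

variable {V : Type*} [NormedAddCommGroup V] [NormedSpace ℝ V] [CompleteSpace V]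
variable {E : Type*} [NormedAddCommGroup E] [NormedSpace ℝ E]
variable {M : Type*} [TopologicalSpace M] [ChartedSpace E M] [IsManifold 𝓘(ℝ, E) ∞ M]

/-- The inverse function theorem in the chart at `f z`. Both halves of the embedding property,
immersion and openness, rest on it. -/
theorem exists_openPartialHomeomorph_chart_comp {f : V → M} {s : TopologicalSpace.Opens V}
    (hf : ContMDiffOn 𝓘(ℝ, V) 𝓘(ℝ, E) ∞ f s) {z : V} (hz : z ∈ s) {f' : V ≃L[ℝ] E}
    (hf' : HasMFDerivAt 𝓘(ℝ, V) 𝓘(ℝ, E) f z (f' : V →L[ℝ] E)) :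
    ∃ h : OpenPartialHomeomorph V E, z ∈ h.source ∧
      h.source ⊆ s ∩ f ⁻¹' (chartAt E (f z)).source ∧ (∀ x, h x = chartAt E (f z) (f x)) ∧
      ContDiffOn ℝ ∞ h h.source ∧ ContDiffOn ℝ ∞ h.symm h.target := by
  set c := chartAt E (f z)
  have hU : IsOpen ((s : Set V) ∩ f ⁻¹' c.source) :=
    hf.continuousOn.isOpen_inter_preimage s.isOpen c.open_source
  have hg : ContDiffOn ℝ ∞ (fun x ↦ c (f x)) (s ∩ f ⁻¹' c.source) := by
    rw [← contMDiffOn_iff_contDiffOn]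
    exact (contMDiffOn_chart (n := ∞)).comp (hf.mono inter_subset_left) fun x hx ↦ hx.2
  have hzc : f z ∈ c.source := mem_chart_source E (f z)
  let c' : E ≃L[ℝ] E := (mdifferentiable_chart (I := 𝓘(ℝ, E)) (f z)).mfderiv hzc
  have hd := ((mdifferentiable_chart (I := 𝓘(ℝ, E)) (f z)).mdifferentiableAt hzc).hasMFDerivAt.comp
    z hf'
  have hd' : HasFDerivAt (fun x ↦ c (f x)) ((f'.trans c' : V ≃L[ℝ] E) : V →L[ℝ] E) z :=
    hd.hasFDerivAt
  obtain ⟨h, hzh, hsub, hcoe, hsymm⟩ :=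
    exists_openPartialHomeomorph_of_contDiffOn hU hg ⟨hz, hzc⟩ (f'.trans c') hd'
  exact ⟨h, hzh, hsub, hcoe, (hg.mono hsub).congr fun x _ ↦ hcoe x, hsymm⟩

/-- An injective local diffeomorphism on an open subset of a Banach space is a smooth embedding. -/
theorem isSmoothEmbedding_of_injOn {f : V → M} {s : TopologicalSpace.Opens V}
    (hf : ContMDiffOn 𝓘(ℝ, V) 𝓘(ℝ, E) ∞ f s)
    (hf' : ∀ z ∈ s, ∃ f' : V ≃L[ℝ] E,
      HasMFDerivAt 𝓘(ℝ, V) 𝓘(ℝ, E) f z (f' : V →L[ℝ] E))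
    (hinj : InjOn f s) :
    Manifold.IsSmoothEmbedding 𝓘(ℝ, V) 𝓘(ℝ, E) ∞ (fun z : s ↦ f z) := by
  have hcont : Continuous (fun z : s ↦ f z) := hf.continuousOn.domRestrict
  constructor
  · refine Manifold.IsImmersionOfComplement.isImmersion (F := PUnit) fun z ↦ ?_
    obtain ⟨f', hz'⟩ := hf' z z.2
    obtain ⟨h, hzh, hsub, hcoe, hsmooth, hsymm⟩ :=
      exists_openPartialHomeomorph_chart_comp hf z.2 hz'
    have hne : Nonempty s := ⟨z⟩
    -- In the chart `d`, which is `h` followed by the inverse of `f'`, the map `f` becomes the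
    -- linear isomorphism `f'`; the complement of its image is trivial, whence `PUnit`.
    set d := ((s.openPartialHomeomorphSubtypeCoe hne).trans h).transHomeomorph
      f'.symm.toHomeomorph with hd
    have hval : ∀ y ∈ d.target, (d.symm y : V) = h.symm (f' y) := by
      intro y hy
      simp only [hd, mfld_simps] at hy
      exact (s.openPartialHomeomorphSubtypeCoe hne).right_inv (x := h.symm (f' y))
        (by rw [TopologicalSpace.Opens.openPartialHomeomorphSubtypeCoe_target]; exact hy.2)
    have hdt : ∀ y ∈ d.target, f' y ∈ h.target := by
      intro y hy
      simp only [hd, mfld_simps] at hy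
      exact hy.1
    have hdmem : d ∈ IsManifold.maximalAtlas 𝓘(ℝ, V) ∞ s := by
      refine d.mem_maximalAtlas_of_contMDiffOn ?_ ?_
      · refine ((f'.symm.contDiff.comp_contDiffOn hsmooth).contMDiffOn).comp
          (contMDiff_subtype_val (U := s)).contMDiffOn fun x hx ↦ ?_
        simp only [hd, mfld_simps] at hx
        exact hx
      · intro y hy
        refine ContMDiffAt.contMDiffWithinAt ?_
        refine (ContMDiffAt.iff_comp_isImmersionAtOfComplement (F := PUnit.{1})
          (Manifold.IsImmersionAtOfComplement.of_opens s (d.symm y))).2 ⟨d.symm.continuousAt hy, ?_⟩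
        have h1 : ContDiffAt ℝ ∞ (fun y ↦ h.symm (f' y)) y :=
          (hsymm.contDiffAt (h.open_target.mem_nhds (hdt y hy))).comp y f'.contDiff.contDiffAt
        refine h1.contMDiffAt.congr_of_eventuallyEq ?_
        filter_upwards [d.open_target.mem_nhds hy] with y' hy' using hval y' hy'
    refine Manifold.IsImmersionAtOfComplement.mk_of_continuousAt hcont.continuousAt
      ((ContinuousLinearEquiv.prodUnique ℝ V PUnit).trans f') d (chartAt E (f z)) ?_
      (mem_chart_source E (f z)) hdmem (IsManifold.chart_mem_maximalAtlas (f z)) ?_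
    · simp only [hd, mfld_simps]
      exact hzh
    · intro y hy
      simp only [mfld_simps] at hy
      simp only [mfld_simps]
      rw [hval y hy, ← hcoe, h.right_inv (hdt y hy)]
      rfl
  · refine (Topology.IsOpenEmbedding.of_continuous_injective_isOpenMap hcont
      (fun z w hzw ↦ Subtype.ext (hinj z.2 w.2 hzw)) ?_).isEmbedding
    rw [isOpenMap_iff_nhds_le]
    intro z
    obtain ⟨f', hz'⟩ := hf' z z.2
    obtain ⟨h, hzh, hsub, hcoe, -, -⟩ := exists_openPartialHomeomorph_chart_comp hf z.2 hz'
    set c := chartAt E (f z)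
    have hne : Nonempty s := ⟨z⟩
    -- `k` is a local homeomorphism that agrees with `f` near `z`, so `f` is open at `z`.
    set k := ((s.openPartialHomeomorphSubtypeCoe hne).trans h).trans c.symm with hk
    have hzk : z ∈ k.source := by
      simp only [hk, mfld_simps]
      exact ⟨hzh, by rw [hcoe]; exact c.map_source (hsub hzh).2⟩
    have hkf : ∀ x ∈ k.source, k x = f x := by
      intro x hx
      simp only [hk, mfld_simps] at hx ⊢
      rw [hcoe, c.left_inv (hsub hx.1).2]
    rw [← hkf z hzk, ← k.map_nhds_eq hzk]
    refine (Filter.map_congr ?_).le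
    filter_upwards [k.open_source.mem_nhds hzk] with x hx using hkf x hx

end Embedding

/-! ### Fibre maps in unitary frames. -/

section Fibres

universe u

variable {E : Type u} [NormedAddCommGroup E] [NormedSpace ℝ E] [FiniteDimensional ℝ E]
variable {M : Type*} [TopologicalSpace M] [ChartedSpace E M] [IsManifold 𝓘(ℝ, E) ∞ M]
variable {Ω : M → E [⋀^Fin 2]→L[ℝ] ℝ} {J : M → E →L[ℝ] E}
  {φ : TangentBundle 𝓘(ℝ, E) M → M} {O : Set (TangentBundle 𝓘(ℝ, E) M)}

/-- A linear map that pulls a form back to a nondegenerate one is injective, hence invertible in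
finite dimension. -/
theorem IsSymplecticThickeningOn.exists_equiv_fibreDeriv
    (hΩ : IsSymplecticForm (E := E) (M := M) Ω) (hφ : IsSymplecticThickeningOn Ω φ O) {m : M}
    {v : E} (hv : (⟨m, v⟩ : TangentBundle 𝓘(ℝ, E) M) ∈ O) :
    ∃ e : E ≃L[ℝ] E, (e : E →L[ℝ] E) = fibreDeriv φ m v := by
  have hinj : Function.Injective (fibreDeriv φ m v).toLinearMap := by
    rw [← LinearMap.ker_eq_bot, LinearMap.ker_eq_bot']
    intro a ha
    have ha' : fibreDeriv φ m v a = 0 := ha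
    refine hΩ.nondegenerate m a fun b ↦ ?_
    have h := hφ.preserves m v hv a b
    rw [ha'] at h
    refine h.symm.trans ?_
    have h0 := twoFormCurry_apply (Ω (φ ⟨m, v⟩)) 0 (fibreDeriv φ m v b)
    rw [← h0, map_zero]
    rfl
  exact ⟨(LinearEquiv.ofInjectiveEndo _ hinj).toContinuousLinearEquiv, by ext; rfl⟩

/-- A symplectic thickening composed with a unitary frame is a symplectic embedding of each ball on
which it is defined and injective. -/
theorem IsSymplecticThickeningOn.isSymplecticBallEmbedding
    (hΩ : IsSymplecticForm (E := E) (M := M) Ω) (hφ : IsSymplecticThickeningOn Ω φ O) {m : M}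
    {ε : ℝ} (hO : ∀ v : E, Ω m ![v, J m v] < ε ^ 2 → ⟨m, v⟩ ∈ O)
    (hinj : InjOn (fun v : E ↦ φ ⟨m, v⟩) {v | Ω m ![v, J m v] < ε ^ 2}) {n : ℕ}
    {u : EuclideanSpace ℂ (Fin n) ≃L[ℝ] E}
    (hu : IsUnitaryFrame (E := E) (M := M) Ω J m u) :
    IsSymplecticBallEmbedding (E := E) (M := M) Ω n ε (fun z ↦ φ ⟨m, u z⟩) := by
  have hball : ∀ z ∈ stdBall n ε, Ω m ![u z, J m (u z)] < ε ^ 2 := by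
    intro z hz
    have h1 : Ω m ![u z, J m (u z)] = ‖z‖ ^ 2 := by
      rw [← stdForm_I_smul, ← hu.map_form, hu.map_I_smul]
      rfl
    rw [h1]
    have h2 : ‖z‖ < ε := mem_ball_zero_iff.1 hz
    exact pow_lt_pow_left₀ h2 (norm_nonneg z) two_ne_zero
  have hderiv : ∀ z ∈ stdBall n ε, HasMFDerivAt 𝓘(ℝ, EuclideanSpace ℂ (Fin n)) 𝓘(ℝ, E)
      (fun z ↦ φ ⟨m, u z⟩) z
      ((fibreDeriv φ m (u z)).comp (u : EuclideanSpace ℂ (Fin n) →L[ℝ] E)) := fun z hz ↦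
    (hφ.mdifferentiableAt_fibre (hO _ (hball z hz))).hasMFDerivAt.comp z u.hasFDerivAt.hasMFDerivAt
  refine ⟨isSmoothEmbedding_of_injOn (f := fun z ↦ φ ⟨m, u z⟩) (s := stdBall n ε) ?_ ?_ ?_, ?_⟩
  · exact hφ.contMDiffOn.comp ((contMDiff_fibreInclusion m).comp
      u.contDiff.contMDiff).contMDiffOn fun z hz ↦ hO _ (hball z hz)
  · intro z hz
    obtain ⟨e, he⟩ := hφ.exists_equiv_fibreDeriv hΩ (hO _ (hball z hz))
    refine ⟨u.trans e, ?_⟩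
    have h := hderiv z hz
    rw [← he] at h
    exact h
  · intro z hz w hw hzw
    exact u.injective (hinj (hball z hz) (hball w hw) hzw)
  · intro z hz a b
    rw [(hderiv z hz).mfderiv, ← hu.map_form]
    exact hφ.preserves m (u z) (hO _ (hball z hz)) (u a) (u b)

end Fibres

end SymplecticThickening

theorem propositionP
    {E : Type*} [NormedAddCommGroup E] [NormedSpace ℝ E] [FiniteDimensional ℝ E]
    {M : Type*} [TopologicalSpace M] [T2Space M] [CompactSpace M]
    [ChartedSpace E M] [IsManifold 𝓘(ℝ, E) ∞ M]
    (n : ℕ) (hn : Module.finrank ℝ E = 2 * n)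
    (Ω : ∀ m : M, TangentSpace 𝓘(ℝ, E) m [⋀^Fin 2]→L[ℝ] ℝ)
    (hΩ : SymplecticThickening.IsSymplecticForm Ω)
    (J : ∀ m : M, TangentSpace 𝓘(ℝ, E) m →L[ℝ] TangentSpace 𝓘(ℝ, E) m)
    (hJ : SymplecticThickening.IsCompatibleAlmostComplex Ω J) :
    ∃ ε₀ : ℝ, 0 < ε₀ ∧ ∀ ε : ℝ, 0 < ε → ε ≤ ε₀ →
      ∃ φ : TangentBundle 𝓘(ℝ, E) M → M,
        ContMDiffOn 𝓘(ℝ, E).tangent 𝓘(ℝ, E) ∞ φ (SymplecticThickening.ballBundle Ω J ε) ∧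
        (∀ m : M, φ ⟨m, 0⟩ = m) ∧
        ∀ m : M,
          (∃ u : EuclideanSpace ℂ (Fin n) ≃L[ℝ] TangentSpace 𝓘(ℝ, E) m,
            SymplecticThickening.IsUnitaryFrame Ω J m u) ∧
          ∀ u : EuclideanSpace ℂ (Fin n) ≃L[ℝ] TangentSpace 𝓘(ℝ, E) m,
            SymplecticThickening.IsUnitaryFrame Ω J m u →
              SymplecticThickening.IsSymplecticBallEmbedding Ω n ε
                (fun z ↦ φ ⟨m, u z⟩) := by
  obtain ⟨φ, O, hφ, hO⟩ := SymplecticThickening.exists_isSymplecticThickeningOn hΩ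
  obtain ⟨ε₀, hε₀, h⟩ := hφ.exists_radius hΩ hJ hO
  -- One `φ` serves all `ε ≤ ε₀`, since the ball bundles shrink with `ε`.
  refine ⟨ε₀, hε₀, fun ε hε hle ↦ ⟨φ, ?_, fun m ↦ hφ.zero m (hO m), fun m ↦ ⟨?_, fun u hu ↦ ?_⟩⟩⟩
  · exact hφ.contMDiffOn.mono fun p hp ↦
      (h p.1).1 p.2 (lt_of_lt_of_le hp (pow_le_pow_left₀ hε.le hle 2))
  · obtain ⟨u, hu, hu'⟩ := SymplecticThickening.exists_unitary_frame (E := E) hn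
      (B := SymplecticThickening.twoFormCurry (E := E) (Ω m)) (J := J m)
      (fun a b ↦ SymplecticThickening.twoForm_swap (E := E) (Ω m) a b) (hJ.sq_eq_neg m) (hJ.invariant m)
      (hJ.pos m)
    exact ⟨u, hu, hu'⟩
  · have hsq : ε ^ 2 ≤ ε₀ ^ 2 := pow_le_pow_left₀ hε.le hle 2
    exact hφ.isSymplecticBallEmbedding hΩ (fun v hv ↦ (h m).1 v (lt_of_lt_of_le hv hsq))
      ((h m).2.mono fun v hv ↦ lt_of_lt_of_le hv hsq) hu
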